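/- Theorem. The problem \textsc{Max-Sum Diverse String Set}, parameterized by the pair $(K, r)$, is fixed-parameter tractable. Here a $\Sigma$-DAG is a finite directed acyclic graph $G=(V,E,s,t)$ with labeled edges $E\subseteq V\times\Sigma\times V$, a source $s$ and a sink $t$, such that every vertex lies on a path from $s$ to $t$. Its size $\mathrm{size}(G)=|E|$ is the number of labeled edges, and $L(G)$ is the set of all strings spelled out by the paths from $s$ to $t$. An instance consists of integers $K, r, \Delta\ge 0$ and a $\Sigma$-DAG $G$ over a finite alphabet $\Sigma$, given with the instance, such that $L(G)\subseteq\Sigma^r$. The question is whether there is a set $\mathcal X\subseteq L(G)$ with $|\mathcal X|=K$ and $$\sum_{\{X,Y\}\subseteq\mathcal X,\;X\ne Y} d_H(X,Y)\;\ge\;\Delta ,$$ where $d_H$ is the Hamming distance. Precisely: there are a computable function $f:\mathbb N^2\to\mathbb N$, a constant $c>0$ and a single word-RAM program that decides every instance in at most $f(K,r)\cdot|x|^c$ steps, where $|x| = 3\,\mathrm{size}(G)+8$ is the number of machine words of the input ($K$, $r$, $\Delta$, $|V|$, $|\Sigma|$, $s$, $t$, $|E|$ and the list of labeled edges in arbitrary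 order, vertices and symbols being numbered from $0$). The program works for every word length $w$ such that all numbers in the input fit into a $w$-bit word and $2^w\ge f(K,r)\cdot|x|^c$, so that the memory the computation can touch is addressable. -/

import Mathlib

/-! ### Sigma-DAGs -/

/-- `Spells E v x u`: some path from `v` to `u` along labeled edges of `E` spells out the string
`x`. -/
inductive Spells {V A : Type*} (E : Finset (V × A × V)) : V → List A → V → Prop
  | nil (v : V) : Spells E v [] v
  | cons {v u z : V} {a : A} {x : List A} :
      (v, a, u) ∈ E → Spells E u x z → Spells E v (a :: x) z

/-- An edge-labeled directed acyclic graph with vertex set `V`, labels from the alphabet `A`,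
source `s` and sink `t`, such that every vertex lies on a path from `s` to `t`.
(Together with acyclicity, the last condition makes `s` the only vertex without incoming edges and
`t` the only vertex without outgoing edges.) -/
structure SigmaDAG (V A : Type*) where
  edges : Finset (V × A × V)
  s : V
  t : V
  acyclic : ∀ (v : V) (x : List A), Spells edges v x v → x = []
  on_path : ∀ v : V, (∃ x, Spells edges s x v) ∧ (∃ y, Spells edges v y t)

/-- The language represented by a Sigma-DAG: all strings spelled out by its paths from `s` to
`t`. -/
def SigmaDAG.language {V A : Type*} (G : SigmaDAG V A) : Language A :=
  {x | Spells G.edges G.s x G.t}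

/-! ### The problem Max-Sum Diverse String Set -/

/-- The sum diversity of a finite set of `r`-strings: the sum of the Hamming distances over all
unordered pairs of its elements (a pair of equal strings contributes `0`). -/
def sumDiversity {A : Type*} [DecidableEq A] {r : ℕ} (X : Finset (Fin r → A)) : ℕ :=
  ∑ p ∈ X.sym2, Sym2.lift ⟨fun x y => hammingDist x y, fun x y => hammingDist_comm x y⟩ p

/-- An instance of Max-Sum Diverse String Set: integers `K`, `r`, `Δ`, and a Sigma-DAG `G` for a set
of `r`-strings. The vertices are numbered `0, …, numV - 1`, the symbols of the alphabet (which is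
part of the input) are numbered `0, …, numA - 1`, and the edges are listed, without repetition, in
an arbitrary order. -/
structure DiverseInstance where
  K : ℕ
  r : ℕ
  Δ : ℕ
  numV : ℕ
  numA : ℕ
  G : SigmaDAG (Fin numV) (Fin numA)
  edgeList : List (Fin numV × Fin numA × Fin numV)
  edgeList_nodup : edgeList.Nodup
  mem_edgeList : ∀ e, e ∈ edgeList ↔ e ∈ G.edges
  length_eq : ∀ x ∈ G.language, x.length = r

/-- The question: is there a set of exactly `K` strings of `L(G)` with sum diversity at least `Δ`? -/
def DiverseInstance.IsYes (I : DiverseInstance) : Prop :=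
  ∃ X : Finset (Fin I.r → Fin I.numA),
    (∀ x ∈ X, List.ofFn x ∈ I.G.language) ∧ X.card = I.K ∧ I.Δ ≤ sumDiversity X

/-- The input as a sequence of words: eight header words (the last one is the number of edges)
followed by three words (tail, label, head) for every edge. Its length is `8 + 3 * size(G)`. -/
def DiverseInstance.encode (I : DiverseInstance) : List ℕ :=
  [I.K, I.r, I.Δ, I.numV, I.numA, I.G.s, I.G.t, I.edgeList.length] ++
    I.edgeList.flatMap fun e => [(e.1 : ℕ), (e.2.1 : ℕ), (e.2.2 : ℕ)]

/-! ### The word RAM -/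

namespace WordRAM

/-- The binary operations on machine words. -/
inductive BinOp
  | add | sub | mul | div | mod | and | or | xor | shl | shr | eq | lt

/-- Arithmetic is modulo `2 ^ w`, unsigned; comparisons return `1` or `0`. -/
def BinOp.eval {w : ℕ} : BinOp → BitVec w → BitVec w → BitVec w
  | .add, a, b => a + b
  | .sub, a, b => a - b
  | .mul, a, b => a * b
  | .div, a, b => a / b
  | .mod, a, b => a % b
  | .and, a, b => a &&& b
  | .or, a, b => a ||| b
  | .xor, a, b => a ^^^ b
  | .shl, a, b => a <<< b
  | .shr, a, b => a >>> b
  | .eq, a, b => if a = b then 1 else 0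
  | .lt, a, b => if a.toNat < b.toNat then 1 else 0

/-- A configuration of the machine with `w`-bit words: registers, and a random access memory with
one word for each of the `2 ^ w` addresses. -/
structure Config (w : ℕ) where
  reg : ℕ → BitVec w
  mem : BitVec w → BitVec w

/-- Expressions: constants, registers, memory reads, and operations. -/
inductive Term
  | const (n : ℕ)
  | reg (i : ℕ)
  | read (a : Term)
  | op (o : BinOp) (a b : Term)

/-- The value of an expression. -/
def Term.eval {w : ℕ} (C : Config w) : Term → BitVec w
  | .const n => BitVec.ofNat w n
  | .reg i => C.reg i
  | .read a => C.mem (a.eval C)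
  | .op o a b => o.eval (a.eval C) (b.eval C)

/-- The number of steps for evaluating an expression: one for each node. -/
def Term.cost : Term → ℕ
  | .const _ => 1
  | .reg _ => 1
  | .read a => a.cost + 1
  | .op _ a b => a.cost + b.cost + 1

/-- Programs of the word RAM, in structured form. A program is a finite object that does not depend
on the word length. -/
inductive Program
  | skip
  | assign (i : ℕ) (a : Term)
  | write (a b : Term)
  | seq (p q : Program)
  | branch (a : Term) (p q : Program)
  | loop (a : Term) (p : Program)

/-- `Runs p C T C'`: started in the configuration `C`, the program `p` halts after exactly `T` steps
in the configuration `C'`. A condition is true if its value is nonzero; `loop` repeats its body as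
long as its condition is true. -/
inductive Runs {w : ℕ} : Program → Config w → ℕ → Config w → Prop
  | skip (C : Config w) : Runs .skip C 1 C
  | assign (C : Config w) (i : ℕ) (a : Term) :
      Runs (.assign i a) C (a.cost + 1) { C with reg := Function.update C.reg i (a.eval C) }
  | write (C : Config w) (a b : Term) :
      Runs (.write a b) C (a.cost + b.cost + 1)
        { C with mem := Function.update C.mem (a.eval C) (b.eval C) }
  | seq {C C₁ C₂ : Config w} {p q : Program} {T₁ T₂ : ℕ} :
      Runs p C T₁ C₁ → Runs q C₁ T₂ C₂ → Runs (.seq p q) C (T₁ + T₂) C₂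
  | branch_true {C C₁ : Config w} {a : Term} {p q : Program} {T : ℕ} :
      a.eval C ≠ 0 → Runs p C T C₁ → Runs (.branch a p q) C (a.cost + 1 + T) C₁
  | branch_false {C C₁ : Config w} {a : Term} {p q : Program} {T : ℕ} :
      a.eval C = 0 → Runs q C T C₁ → Runs (.branch a p q) C (a.cost + 1 + T) C₁
  | loop_true {C C₁ C₂ : Config w} {a : Term} {p : Program} {T₁ T₂ : ℕ} :
      a.eval C ≠ 0 → Runs p C T₁ C₁ → Runs (.loop a p) C₁ T₂ C₂ →
        Runs (.loop a p) C (a.cost + 1 + T₁ + T₂) C₂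
  | loop_false {C : Config w} {a : Term} {p : Program} :
      a.eval C = 0 → Runs (.loop a p) C (a.cost + 1) C

/-- The initial configuration: the input words stand in memory from address `0` on, and everything
else is zero. -/
def initial (w : ℕ) (input : List ℕ) : Config w where
  reg := fun _ => 0
  mem := fun a => BitVec.ofNat w (input.getD a.toNat 0)

open Classical in
/-- A problem with instances `X`, encoded by `enc` as sequences of numbers, and with parameter `κ` is
fixed-parameter tractable: there are a single program, a computable function `f` and a constant
`c > 0` such that, on every instance `x`, the program halts within `f (κ x) * |x| ^ c` steps, with
`1` in register `0` if `x` is a yes-instance and `0` otherwise; here `|x|` is the number of input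
words. The words may have any length `w` such that every number in the input fits into a word, and
such that the at most `f (κ x) * |x| ^ c` memory cells that the computation can touch have
addresses (so that, for a fixed parameter, words of `Θ(log |x|)` bits suffice for inputs whose
numbers are polynomially bounded in `|x|`). -/
def FixedParameterTractable {X P : Type*} [Primcodable P]
    (enc : X → List ℕ) (κ : X → P) (yes : X → Prop) : Prop :=
  ∃ (p : Program) (f : P → ℕ) (c : ℕ), Computable f ∧ 0 < c ∧
    ∀ (x : X) (w : ℕ), (∀ a ∈ enc x, a < 2 ^ w) →
      f (κ x) * (enc x).length ^ c ≤ 2 ^ w →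
      ∃ (T : ℕ) (C : Config w), Runs p (initial w (enc x)) T C ∧
        T ≤ f (κ x) * (enc x).length ^ c ∧
        C.reg 0 = if yes x then 1 else 0

end WordRAM

/-! The language can be replaced by a set of strings whose size depends only on K and r. Call a set
R ⊆ L(G) representative if, for every set F of at most rK pairs (position, symbol), R contains a
string avoiding F whenever L(G) does. Given a solution X and x ∈ X outside R, let F consist of the
pairs (p, y_p) with y ∈ X \ {x} and y_p ≠ x_p. The string x avoids F, so some x' ∈ R does too. It
differs from each y wherever x does, so replacing x by x' loses neither diversity nor distinctness.
Repeating this moves all of X into R (`exists_diverse_subset`).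

A representative set comes from a search tree with r children per node. A node carries a set of
forbidden pairs and a string of L(G) that avoids them if any does; child p additionally forbids the
p-th symbol of that string. To find a string avoiding F, start at the root, where nothing is
forbidden. While the current string hits F at some position p, descend to child p. Each descent adds
a new element of F to the forbidden set, so the search ends at depth at most |F|
(`exists_node_avoiding`). In heap numbering, the first N = (r+1)^(rK) nodes suffice. Hence the
instance is positive iff one of the N^K tuples of node strings is a solution
(`DiverseInstance.isYes_iff`).

The string of a node is found by layered reachability in G without the forbidden pairs. Each reached
cell remembers its last edge, and the string is read off backwards from the sink (`ok_searchProg`,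
`ok_extractProg`). This takes time linear in the number of edges, up to a factor in K and r.

The program is verified over natural numbers by Hoare-style rules that bound the steps. Overflow is
excluded since every number that occurs is below the time bound or is an input word. -/

namespace WordRAM

/-! ### States with natural-number contents -/

/-- A state of the word RAM whose registers and memory cells hold natural numbers. -/
@[ext]
structure NState where
  reg : ℕ → ℕ
  mem : ℕ → ℕ

namespace NState

/-- Assignment to a register. -/
def set (S : NState) (i v : ℕ) : NState := ⟨Function.update S.reg i v, S.mem⟩

/-- Assignment to a memory cell. -/
def wr (S : NState) (a v : ℕ) : NState := ⟨S.reg, Function.update S.mem a v⟩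

lemma set_reg_of_ne (S : NState) {i j : ℕ} (v : ℕ) (h : j ≠ i) :
    (S.set i v).reg j = S.reg j := by simp [set, h]

@[simp] lemma set_reg (S : NState) (i v j : ℕ) :
    (S.set i v).reg j = if j = i then v else S.reg j := by simp [set, Function.update_apply]

@[simp] lemma set_mem (S : NState) (i v : ℕ) : (S.set i v).mem = S.mem := rfl

@[simp] lemma wr_reg (S : NState) (a v : ℕ) : (S.wr a v).reg = S.reg := rfl

lemma wr_mem (S : NState) (a v b : ℕ) :
    (S.wr a v).mem b = if b = a then v else S.mem b := by simp [wr, Function.update_apply]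

-- Frame conditions say that the registers below some index are unchanged; with this rule `simp`
-- sees through an assignment to a register at or above that index.
@[simp] lemma forall_lt_ite {f g : ℕ → ℕ} {l i v : ℕ} (h : l ≤ i) :
    (∀ j < l, (if j = i then v else f j) = g j) ↔ ∀ j < l, f j = g j :=
  forall₂_congr fun j hj => by rw [if_neg (by omega)]

@[simp] lemma forall_lt_eq_imp {l i : ℕ} {p : ℕ → Prop} (h : l ≤ i) :
    (∀ j < l, j = i → p j) ↔ True :=
  iff_true_intro fun j hj h' => absurd h' (by omega)

/-- The configuration of the machine with `w`-bit words that represents a state. -/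
def config (w : ℕ) (S : NState) : Config w :=
  ⟨fun i => BitVec.ofNat w (S.reg i), fun a => BitVec.ofNat w (S.mem a.toNat)⟩

/-- All numbers in the state fit into a word. -/
structure Bounded (w : ℕ) (S : NState) : Prop where
  one_lt : 1 < 2 ^ w
  reg_lt : ∀ i, S.reg i < 2 ^ w
  mem_lt : ∀ a, S.mem a < 2 ^ w

lemma Bounded.set {w : ℕ} {S : NState} (h : S.Bounded w) (i : ℕ) {v : ℕ} (hv : v < 2 ^ w) :
    (S.set i v).Bounded w :=
  ⟨h.one_lt, fun j => by rw [set_reg]; split_ifs; exacts [hv, h.reg_lt j], h.mem_lt⟩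

lemma Bounded.wr {w : ℕ} {S : NState} (h : S.Bounded w) (a : ℕ) {v : ℕ} (hv : v < 2 ^ w) :
    (S.wr a v).Bounded w :=
  ⟨h.one_lt, h.reg_lt, fun b => by rw [wr_mem]; split_ifs; exacts [hv, h.mem_lt b]⟩

lemma config_set (w : ℕ) (S : NState) (i v : ℕ) :
    (S.set i v).config w =
      { S.config w with reg := Function.update (S.config w).reg i (BitVec.ofNat w v) } := by
  simp only [config, set_mem, Config.mk.injEq, and_true]
  funext j
  simp only [set_reg, Function.update_apply]
  split_ifs <;> rfl

lemma config_wr (w : ℕ) (S : NState) {a : ℕ} (v : ℕ) (ha : a < 2 ^ w) :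
    (S.wr a v).config w =
      { S.config w with
        mem := Function.update (S.config w).mem (BitVec.ofNat w a) (BitVec.ofNat w v) } := by
  simp only [config, wr_reg, Config.mk.injEq, true_and]
  funext b
  have : b.toNat = a ↔ b = BitVec.ofNat w a := by
    rw [← BitVec.toNat_inj, BitVec.toNat_ofNat, Nat.mod_eq_of_lt ha]
  simp only [wr_mem, Function.update_apply, this]
  split_ifs <;> rfl

end NState

/-! ### Arithmetic without overflow -/

/-- The operations on natural numbers (only those needed here). -/
def BinOp.nat : BinOp → ℕ → ℕ → ℕ
  | .add, a, b => a + b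
  | .sub, a, b => a - b
  | .mul, a, b => a * b
  | .div, a, b => a / b
  | .mod, a, b => a % b
  | .eq, a, b => if a = b then 1 else 0
  | .lt, a, b => if a < b then 1 else 0
  | _, _, _ => 0

/-- The operation on `w`-bit words agrees with the one on natural numbers. -/
def BinOp.Safe (w : ℕ) : BinOp → ℕ → ℕ → Prop
  | .add, a, b => a + b < 2 ^ w
  | .sub, a, b => b ≤ a
  | .mul, a, b => a * b < 2 ^ w
  | .div, _, _ => True
  | .mod, _, _ => True
  | .eq, _, _ => True
  | .lt, _, _ => True
  | _, _, _ => False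

/-- The value of an expression in natural numbers. -/
def Term.val (S : NState) : Term → ℕ
  | .const n => n
  | .reg i => S.reg i
  | .read a => S.mem (a.val S)
  | .op o a b => o.nat (a.val S) (b.val S)

/-- The evaluation of an expression with `w`-bit words does not overflow. -/
def Term.Safe (w : ℕ) (S : NState) : Term → Prop
  | .const n => n < 2 ^ w
  | .reg _ => True
  | .read a => a.Safe w S
  | .op o a b => a.Safe w S ∧ b.Safe w S ∧ o.Safe w (a.val S) (b.val S)

lemma BinOp.eval_ofNat {w : ℕ} (o : BinOp) {a b : ℕ} (hw : 1 < 2 ^ w) (ha : a < 2 ^ w)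
    (hb : b < 2 ^ w) (h : o.Safe w a b) :
    o.eval (BitVec.ofNat w a) (BitVec.ofNat w b) = BitVec.ofNat w (o.nat a b) ∧
      o.nat a b < 2 ^ w := by
  -- The bitwise operations and shifts are never safe, so their cases vanish here.
  cases o <;> simp only [BinOp.Safe] at h <;> simp only [BinOp.eval, BinOp.nat]
  · exact ⟨by rw [BitVec.ofNat_add], h⟩
  · refine ⟨?_, by omega⟩
    apply BitVec.eq_of_toNat_eq
    simp only [BitVec.toNat_sub, BitVec.toNat_ofNat, Nat.mod_eq_of_lt ha, Nat.mod_eq_of_lt hb]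
    rw [show 2 ^ w - b + a = 2 ^ w + (a - b) by omega, Nat.add_mod_left]
  · exact ⟨by rw [BitVec.ofNat_mul], h⟩
  · have hd : a / b < 2 ^ w := (Nat.div_le_self _ _).trans_lt ha
    refine ⟨?_, hd⟩
    apply BitVec.eq_of_toNat_eq
    simp [BitVec.toNat_udiv, Nat.mod_eq_of_lt ha, Nat.mod_eq_of_lt hb, Nat.mod_eq_of_lt hd]
  · have hd : a % b < 2 ^ w := (Nat.mod_le _ _).trans_lt ha
    refine ⟨?_, hd⟩
    apply BitVec.eq_of_toNat_eq
    simp [BitVec.toNat_umod, Nat.mod_eq_of_lt ha, Nat.mod_eq_of_lt hb, Nat.mod_eq_of_lt hd]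
  · have : BitVec.ofNat w a = BitVec.ofNat w b ↔ a = b := by
      rw [← BitVec.toNat_inj, BitVec.toNat_ofNat, BitVec.toNat_ofNat, Nat.mod_eq_of_lt ha,
        Nat.mod_eq_of_lt hb]
    simp only [this]
    split_ifs
    · exact ⟨rfl, hw⟩
    · exact ⟨rfl, by omega⟩
  · simp only [BitVec.toNat_ofNat, Nat.mod_eq_of_lt ha, Nat.mod_eq_of_lt hb]
    split_ifs
    · exact ⟨rfl, hw⟩
    · exact ⟨rfl, by omega⟩

/-- The bound has to be proved along with the value: a memory read is faithful only if its address
does not wrap around. -/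
lemma Term.eval_config {w : ℕ} {S : NState} (hS : S.Bounded w) (t : Term) (h : t.Safe w S) :
    t.eval (S.config w) = BitVec.ofNat w (t.val S) ∧ t.val S < 2 ^ w := by
  induction t with
  | const n => exact ⟨rfl, h⟩
  | reg i => exact ⟨rfl, hS.reg_lt i⟩
  | read a ih =>
    obtain ⟨h1, h2⟩ := ih h
    refine ⟨?_, hS.mem_lt _⟩
    rw [Term.eval, h1]
    change BitVec.ofNat w (S.mem (BitVec.ofNat w _).toNat) = _
    rw [BitVec.toNat_ofNat, Nat.mod_eq_of_lt h2, Term.val]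
  | op o a b iha ihb =>
    obtain ⟨ha, hb, ho⟩ := h
    obtain ⟨a1, a2⟩ := iha ha
    obtain ⟨b1, b2⟩ := ihb hb
    simp only [Term.eval, Term.val, a1, b1]
    exact o.eval_ofNat hS.one_lt a2 b2 ho

lemma Term.eval_ne_zero_iff {w : ℕ} {S : NState} (hS : S.Bounded w) {t : Term}
    (h : t.Safe w S) : t.eval (S.config w) ≠ 0 ↔ t.val S ≠ 0 := by
  obtain ⟨h1, h2⟩ := t.eval_config hS h
  rw [h1, not_iff_not, ← BitVec.toNat_inj, BitVec.toNat_ofNat, Nat.mod_eq_of_lt h2]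
  simp

/-- Started in the state `S`, the program `p` halts within `T` steps in a state that
satisfies `Q`. -/
def Ok (w : ℕ) (p : Program) (S : NState) (T : ℕ) (Q : NState → Prop) : Prop :=
  S.Bounded w → ∃ T' ≤ T, ∃ S' : NState, S'.Bounded w ∧
    Runs p (S.config w) T' (S'.config w) ∧ Q S'

/-! ### Hoare-style rules with step counts -/

section Rules

variable {w : ℕ} {S : NState} {Q R : NState → Prop} {p q : Program} {T T₁ T₂ : ℕ}

lemma Ok.mono (h : Ok w p S T₁ R) (hT : T₁ ≤ T) (hQ : ∀ S', R S' → Q S') : Ok w p S T Q := by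
  intro hS
  obtain ⟨T', hT', S', hS', hr, h'⟩ := h hS
  exact ⟨T', hT'.trans hT, S', hS', hr, hQ _ h'⟩

lemma Ok.time (h : Ok w p S T₁ Q) (hT : T₁ ≤ T) : Ok w p S T Q := h.mono hT fun _ h => h

lemma ok_skip (h : Q S) : Ok w .skip S 1 Q := fun hS => ⟨1, le_rfl, S, hS, .skip _, h⟩

lemma ok_assign {i : ℕ} {t : Term} (ht : t.Safe w S) (h : Q (S.set i (t.val S))) :
    Ok w (.assign i t) S (t.cost + 1) Q := by
  intro hS
  obtain ⟨h1, h2⟩ := t.eval_config hS ht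
  refine ⟨_, le_rfl, _, hS.set i h2, ?_, h⟩
  rw [NState.config_set, ← h1]
  exact .assign _ _ _

lemma ok_write {a b : Term} (ha : a.Safe w S) (hb : b.Safe w S)
    (h : Q (S.wr (a.val S) (b.val S))) :
    Ok w (.write a b) S (a.cost + b.cost + 1) Q := by
  intro hS
  obtain ⟨a1, a2⟩ := a.eval_config hS ha
  obtain ⟨b1, b2⟩ := b.eval_config hS hb
  refine ⟨_, le_rfl, _, hS.wr _ b2, ?_, h⟩
  rw [NState.config_wr _ _ _ a2, ← a1, ← b1]
  exact .write _ _ _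

lemma Ok.seq (hp : Ok w p S T₁ R) (hq : ∀ S', R S' → Ok w q S' T₂ Q) :
    Ok w (.seq p q) S (T₁ + T₂) Q := by
  intro hS
  obtain ⟨T', hT', S', hS', hr, h'⟩ := hp hS
  obtain ⟨T'', hT'', S'', hS'', hr', h''⟩ := hq S' h' hS'
  exact ⟨_, Nat.add_le_add hT' hT'', S'', hS'', .seq hr hr', h''⟩

lemma ok_assign_seq {i : ℕ} {t : Term} (ht : t.Safe w S) (h : Ok w p (S.set i (t.val S)) T Q) :
    Ok w (.seq (.assign i t) p) S (t.cost + 1 + T) Q :=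
  (ok_assign (Q := fun S' => S' = S.set i (t.val S)) ht rfl).seq fun _ h' => h' ▸ h

lemma ok_write_seq {a b : Term} (ha : a.Safe w S) (hb : b.Safe w S)
    (h : Ok w p (S.wr (a.val S) (b.val S)) T Q) :
    Ok w (.seq (.write a b) p) S (a.cost + b.cost + 1 + T) Q :=
  (ok_write (Q := fun S' => S' = S.wr (a.val S) (b.val S)) ha hb rfl).seq fun _ h' => h' ▸ h

lemma ok_branch {a : Term} (ha : a.Safe w S) (hp : a.val S ≠ 0 → Ok w p S T₁ Q)
    (hq : a.val S = 0 → Ok w q S T₂ Q) :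
    Ok w (.branch a p q) S (a.cost + 1 + (T₁ + T₂)) Q := by
  intro hS
  have hi := Term.eval_ne_zero_iff hS ha
  by_cases h : a.val S = 0
  · obtain ⟨T', hT', S', hS', hr, h'⟩ := hq h hS
    exact ⟨a.cost + 1 + T', by omega, S', hS',
      .branch_false (by simpa using (not_congr hi).2 (not_not.2 h)) hr, h'⟩
  · obtain ⟨T', hT', S', hS', hr, h'⟩ := hp h hS
    exact ⟨a.cost + 1 + T', by omega, S', hS', .branch_true (hi.2 h) hr, h'⟩

/-- A loop during which some measure decreases. -/
lemma ok_loop {a : Term} (Inv : ℕ → NState → Prop) (Tb : ℕ)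
    (ha : ∀ m S, Inv m S → a.Safe w S)
    (hexit : ∀ m S, Inv m S → a.val S = 0 → Q S)
    (hbody : ∀ m S, Inv m S → a.val S ≠ 0 →
      Ok w p S Tb fun S' => ∃ m' < m, Inv m' S')
    (m : ℕ) (S : NState) (h : Inv m S) :
    Ok w (.loop a p) S ((m + 1) * (a.cost + 1 + Tb)) Q := by
  induction m using Nat.strong_induction_on generalizing S with
  | _ m ih =>
    intro hS
    have hi := Term.eval_ne_zero_iff hS (ha _ _ h)
    by_cases h0 : a.val S = 0
    · refine ⟨a.cost + 1, by nlinarith, S, hS,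
        .loop_false (by simpa using (not_congr hi).2 (not_not.2 h0)), hexit _ _ h h0⟩
    · obtain ⟨T', hT', S', hS', hr, m', hm', h'⟩ := hbody _ _ h h0 hS
      obtain ⟨T'', hT'', S'', hS'', hr', h''⟩ := ih m' hm' S' h' hS'
      refine ⟨a.cost + 1 + T' + T'', ?_, S'', hS'', .loop_true (hi.2 h0) hr hr', h''⟩
      -- Since `m' < m`, the bound for the remaining rounds leaves one summand for the present
      -- round. The summand beyond the measure pays for the final failing test.
      have : (m' + 1 + 1) * (a.cost + 1 + Tb) ≤ (m + 1) * (a.cost + 1 + Tb) :=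
        Nat.mul_le_mul_right _ (by omega)
      nlinarith

/-- The loop in which register `i` counts from `0` to the value of register `j`. -/
def forLoop (i j : ℕ) (p : Program) : Program :=
  .seq (.assign i (.const 0))
    (.loop (.op .lt (.reg i) (.reg j)) (.seq p (.assign i (.op .add (.reg i) (.const 1)))))

/-- The body must restore the counter and the bound, and it owes the next invariant in the state
after the increment. The additional 10 steps per round cover the test, the increment and the
initialization. -/
lemma ok_for {i j : ℕ} (hij : j ≠ i) (Inv : ℕ → NState → Prop) (n Tb : ℕ)
    (hj : S.reg j = n) (hw : 1 < 2 ^ w) (hn : n < 2 ^ w)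
    (h0 : Inv 0 (S.set i 0))
    (hbody : ∀ k S, k < n → S.reg i = k → S.reg j = n → Inv k S →
      Ok w p S Tb fun S' => S'.reg i = k ∧ S'.reg j = n ∧ Inv (k + 1) (S'.set i (k + 1)))
    (hQ : ∀ S, Inv n S → Q S) :
    Ok w (forLoop i j p) S ((n + 1) * (Tb + 10)) Q := by
  refine (ok_assign_seq (by simp only [Term.Safe]; omega)
    (ok_loop (fun m S => S.reg j = n ∧ S.reg i ≤ n ∧ m = n - S.reg i ∧ Inv (S.reg i) S) (Tb + 4)
      ?_ ?_ ?_ n _ ?_)).time ?_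
  · intros
    simp [Term.Safe, BinOp.Safe]
  · rintro m S ⟨h1, h2, -, h4⟩ h5
    simp only [Term.val, BinOp.nat, h1, ite_eq_right_iff, one_ne_zero, imp_false, not_lt] at h5
    rw [le_antisymm h2 h5] at h4
    exact hQ _ h4
  · rintro m S ⟨h1, h2, h3, h4⟩ h5
    have h6 : S.reg i < n := by
      by_contra hc
      simp [Term.val, BinOp.nat, h1, hc] at h5
    refine (hbody _ S h6 rfl h1 h4).seq ?_
    rintro S' ⟨g1, g2, g3⟩
    refine ok_assign ?_ ?_
    · simp only [Term.Safe, BinOp.Safe, Term.val, g1]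
      exact ⟨trivial, hw, by omega⟩
    · simp only [Term.val, BinOp.nat, g1]
      refine ⟨m - 1, by omega, ?_, ?_, ?_, ?_⟩
      · simp [hij, g2]
      · simp; omega
      · simp; omega
      · simpa using g3
  · simp only [Term.val]
    refine ⟨by simp [hij, hj], by simp, by simp, by simpa using h0⟩
  · simp only [Term.cost]
    nlinarith

end Rules

end WordRAM

/-! ### Exchanging strings -/

section Exchange

variable {A : Type*} [DecidableEq A] {r : ℕ}

/-- The new unordered pairs are those containing `x`; the diagonal one contributes 0. -/
lemma sumDiversity_insert {X : Finset (Fin r → A)} {x : Fin r → A} (hx : x ∉ X) :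
    sumDiversity (insert x X) = sumDiversity X + ∑ y ∈ X, hammingDist x y := by
  unfold sumDiversity
  rw [Finset.sym2_insert, Finset.sum_union, Finset.sum_image, Finset.sum_insert hx, add_comm]
  · simp
  · intro a _ b _ h
    exact Sym2.congr_right.1 h
  · rw [Finset.disjoint_left]
    intro p hp hp'
    obtain ⟨b, -, rfl⟩ := Finset.mem_image.1 hp
    exact hx (Finset.mk_mem_sym2_iff.1 hp').1

lemma sumDiversity_image_range (x : ℕ → Fin r → A) (k : ℕ)
    (hx : ∀ i < k, ∀ j < i, x i ≠ x j) :
    ((Finset.range k).image x).card = k ∧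
    sumDiversity ((Finset.range k).image x) =
      ∑ i ∈ Finset.range k, ∑ j ∈ Finset.range i, hammingDist (x i) (x j) := by
  induction k with
  | zero => simp [sumDiversity]
  | succ k ih =>
    obtain ⟨h1, h2⟩ := ih fun i hi => hx i (hi.trans (Nat.lt_succ_self k))
    have hk : x k ∉ (Finset.range k).image x := by
      intro h
      obtain ⟨j, hj, hjk⟩ := Finset.mem_image.1 h
      exact hx k (Nat.lt_succ_self k) j (Finset.mem_range.1 hj) hjk.symm
    rw [Finset.range_add_one, Finset.image_insert, Finset.card_insert_of_notMem hk, h1,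
      sumDiversity_insert hk, h2, Finset.sum_insert Finset.notMem_range_self,
      Finset.sum_image]
    · exact ⟨rfl, add_comm _ _⟩
    · refine Finset.card_image_iff.1 ?_
      rw [h1, Finset.card_range]

/-- If `R` contains with every string of `L` that avoids a small set of (position, symbol) pairs
another one that does, then the diversity of a subset of `L` is attained by a subset of `R`. -/
lemma exists_diverse_subset {K : ℕ} {L R : Set (Fin r → A)}
    (hR : ∀ F : Finset (Fin r × A), F.card ≤ r * K → (∃ x ∈ L, ∀ p, (p, x p) ∉ F) →
      ∃ x ∈ R, ∀ p, (p, x p) ∉ F)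
    (hRL : R ⊆ L) (X : Finset (Fin r → A)) (hX : ∀ x ∈ X, x ∈ L) (hK : X.card = K) :
    ∃ Y : Finset (Fin r → A), (∀ y ∈ Y, y ∈ R) ∧ Y.card = K ∧
      sumDiversity X ≤ sumDiversity Y := by
  classical
  induction hn : (X.filter (· ∉ R)).card using Nat.strong_induction_on generalizing X with
  | _ n ih =>
    subst hn
    by_cases hall : ∀ x ∈ X, x ∈ R
    · exact ⟨X, hall, hK, le_rfl⟩
    push Not at hall
    obtain ⟨x, hxX, hxR⟩ := hall
    set Y := X.erase x with hY
    have hxY : x ∉ Y := Finset.notMem_erase x X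
    have hXY : insert x Y = X := Finset.insert_erase hxX
    have hYK : Y.card + 1 = K := by rw [← Finset.card_insert_of_notMem hxY, hXY, hK]
    -- Only disagreements with `x` are recorded, so that `x` itself avoids `F`.
    set F : Finset (Fin r × A) :=
      ((Finset.univ ×ˢ Y).image fun q => (q.1, q.2 q.1)).filter fun q => x q.1 ≠ q.2 with hF
    have hFc : F.card ≤ r * K := by
      refine (Finset.card_filter_le _ _).trans (Finset.card_image_le.trans ?_)
      rw [Finset.card_product, Finset.card_univ, Fintype.card_fin]
      exact Nat.mul_le_mul_left _ (by omega)
    obtain ⟨x', hx'R, hx'⟩ := hR F hFc ⟨x, hX x hxX, fun p hp => by simp [hF] at hp⟩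
    -- A position where `x` and `y` differ puts the symbol of `y` into `F`, so `x'` differs from `y`
    -- there as well.
    have hd : ∀ y ∈ Y, hammingDist x y ≤ hammingDist x' y := by
      intro y hy
      refine Finset.card_le_card fun p hp => ?_
      simp only [Finset.mem_filter, Finset.mem_univ, true_and] at hp ⊢
      intro h
      refine hx' p ?_
      rw [h, hF, Finset.mem_filter]
      exact ⟨Finset.mem_image.2 ⟨(p, y), by simp [hy], rfl⟩, hp⟩
    -- If `x'` were in `Y`, its distance 0 to itself would bound its distance to `x`, forcing `x =
    -- x' ∈ Y`.
    have hx'Y : x' ∉ Y := by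
      intro h
      have h0 := hd x' h
      rw [hammingDist_self, Nat.le_zero, hammingDist_eq_zero] at h0
      exact hxY (h0 ▸ h)
    have hX' : ∀ z ∈ insert x' Y, z ∈ L := by
      intro z hz
      rcases Finset.mem_insert.1 hz with rfl | hz
      · exact hRL hx'R
      · exact hX z (Finset.mem_of_mem_erase hz)
    have hlt : ((insert x' Y).filter (· ∉ R)).card < (X.filter (· ∉ R)).card := by
      refine Finset.card_lt_card (Finset.ssubset_iff_subset_ne.2 ⟨?_, ?_⟩)
      · intro z hz
        rw [Finset.mem_filter] at hz ⊢
        rcases Finset.mem_insert.1 hz.1 with rfl | h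
        · exact absurd hx'R hz.2
        · exact ⟨Finset.mem_of_mem_erase h, hz.2⟩
      · intro h
        have : x ∈ (insert x' Y).filter (· ∉ R) := by
          rw [h]
          exact Finset.mem_filter.2 ⟨hxX, hxR⟩
        rcases Finset.mem_insert.1 (Finset.mem_filter.1 this).1 with rfl | h'
        · exact hxR hx'R
        · exact hxY h'
    obtain ⟨Z, hZ, hZK, hZd⟩ := ih _ hlt (insert x' Y) hX'
      (by rw [Finset.card_insert_of_notMem hx'Y, hYK]) rfl
    refine ⟨Z, hZ, hZK, le_trans ?_ hZd⟩
    rw [← hXY, sumDiversity_insert hxY, sumDiversity_insert hx'Y]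
    exact Nat.add_le_add_left (Finset.sum_le_sum hd) _

end Exchange

/-! ### The search tree -/

/-- The set of pairs (position, symbol) forbidden at a node of the `r`-ary tree whose nodes are
numbered as in a heap, if the string `P n` is attached to the node `n`: the child of `n` in
direction `p` forbids the `p`-th symbol of `P n` at position `p`. -/
def forbidden (r : ℕ) (P : ℕ → ℕ → ℕ) : ℕ → Finset (ℕ × ℕ)
  | 0 => ∅
  | n + 1 => insert (n % r, P (n / r) (n % r)) (forbidden r P (n / r))
  decreasing_by exact Nat.lt_succ_of_le (Nat.div_le_self _ _)

lemma forbidden_zero (r : ℕ) (P : ℕ → ℕ → ℕ) : forbidden r P 0 = ∅ := by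
  rw [forbidden]

lemma forbidden_succ (r : ℕ) (P : ℕ → ℕ → ℕ) (n : ℕ) : forbidden r P (n + 1) =
    insert (n % r, P (n / r) (n % r)) (forbidden r P (n / r)) := by
  rw [forbidden]

/-- The forbidden set depends only on the strings at proper ancestors, and these have smaller
numbers. -/
lemma forbidden_congr {r : ℕ} (hr : 0 < r) {P P' : ℕ → ℕ → ℕ} (n : ℕ)
    (h : ∀ m < n, ∀ p < r, P m p = P' m p) : forbidden r P n = forbidden r P' n := by
  induction n using Nat.strong_induction_on with
  | _ n ih =>
    cases n with
    | zero => rw [forbidden_zero, forbidden_zero]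
    | succ n =>
      have hn : n / r < n + 1 := Nat.lt_succ_of_le (Nat.div_le_self _ _)
      rw [forbidden_succ, forbidden_succ, h _ hn _ (Nat.mod_lt _ hr),
        ih _ hn fun m hm => h m (hm.trans hn)]

/-- The string `P n` belongs to the language and, if possible, avoids what is forbidden at `n`. -/
def GoodNode (r : ℕ) (L : (ℕ → ℕ) → Prop) (P : ℕ → ℕ → ℕ) (n : ℕ) : Prop :=
  L (P n) ∧ ((∃ y, L y ∧ ∀ p < r, (p, y p) ∉ forbidden r P n) →
    ∀ p < r, (p, P n p) ∉ forbidden r P n)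

/-- Descend from the root: if the string at the current node hits `F` at position `p`, go to child
`p`. The forbidden set stays inside `F` and grows by one pair each time. -/
lemma exists_node_avoiding {r q : ℕ} {L : (ℕ → ℕ) → Prop} {P : ℕ → ℕ → ℕ}
    (hP : ∀ n < (r + 1) ^ q, GoodNode r L P n) (F : Finset (ℕ × ℕ)) (hF : F.card ≤ q)
    (hL : ∃ y, L y ∧ ∀ p < r, (p, y p) ∉ F) :
    ∃ n < (r + 1) ^ q, ∀ p < r, (p, P n p) ∉ F := by
  -- The size of the forbidden set serves as the depth. The induction is on the number of pairs of
  -- `F` that are not yet forbidden.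
  suffices ∀ d n, forbidden r P n ⊆ F → F.card - (forbidden r P n).card = d →
      n < (r + 1) ^ (forbidden r P n).card → ∃ n < (r + 1) ^ q, ∀ p < r, (p, P n p) ∉ F from
    this _ 0 (by simp [forbidden_zero]) rfl (by simp)
  intro d
  induction d with
  | zero =>
    intro n hn hd hlt
    have hFn := Finset.eq_of_subset_of_card_le hn (by omega)
    rw [hFn] at hlt
    have hlt' := hlt.trans_le (Nat.pow_le_pow_right (Nat.succ_pos r) hF)
    have := (hP n hlt').2
    rw [hFn] at this
    exact ⟨n, hlt', this hL⟩
  | succ d ih =>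
    intro n hn hd hlt
    have hlt' := hlt.trans_le
      (Nat.pow_le_pow_right (Nat.succ_pos r) ((Finset.card_le_card hn).trans hF))
    have hav := (hP n hlt').2 (hL.imp fun y hy => ⟨hy.1, fun p hp h => hy.2 p hp (hn h)⟩)
    by_cases hall : ∀ p < r, (p, P n p) ∉ F
    · exact ⟨n, hlt', hall⟩
    push Not at hall
    obtain ⟨p, hp, hpF⟩ := hall
    have hf : forbidden r P (r * n + p + 1) = insert (p, P n p) (forbidden r P n) := by
      rw [forbidden_succ, Nat.mul_add_mod, Nat.mod_eq_of_lt hp,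
        Nat.mul_add_div (by omega), Nat.div_eq_of_lt hp, add_zero]
    -- The added pair is new because `P n` avoids what is forbidden at `n`.
    have hc : (forbidden r P (r * n + p + 1)).card = (forbidden r P n).card + 1 := by
      rw [hf, Finset.card_insert_of_notMem (hav p hp)]
    refine ih (r * n + p + 1) ?_ (by omega) ?_
    · rw [hf]
      exact Finset.insert_subset hpF hn
    -- The child's number is at most r(n + 1), hence below (r + 1) times the bound for `n`.
    · rw [hc, pow_succ]
      nlinarith

/-! ### Reachability -/

/-- In the graph with `E` edges with tails `tl`, labels `lb`, heads `hd`, a path from `s` to `u`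
spells out the first `i` symbols of `y`. -/
def Reach (E : ℕ) (tl lb hd : ℕ → ℕ) (s : ℕ) (y : ℕ → ℕ) : ℕ → ℕ → Prop
  | 0, u => u = s
  | i + 1, u => ∃ k < E, Reach E tl lb hd s y i (tl k) ∧ lb k = y i ∧ hd k = u

lemma Reach.congr {E : ℕ} {tl lb hd : ℕ → ℕ} {s : ℕ} {y y' : ℕ → ℕ} {i u : ℕ}
    (h : Reach E tl lb hd s y i u) (hy : ∀ p < i, y p = y' p) : Reach E tl lb hd s y' i u := by
  induction i generalizing u with
  | zero => exact h
  | succ i ih =>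
    obtain ⟨k, hk, h1, h2, h3⟩ := h
    exact ⟨k, hk, ih h1 fun p hp => hy p (by omega), h2.trans (hy i (by omega)), h3⟩

/-- `Spells` grows at the front of a path, `Reach` at its end; this allows induction from the end.
-/
lemma Spells.concat_iff {V A : Type*} {E : Finset (V × A × V)} {v z : V} {x : List A} {a : A} :
    Spells E v (x ++ [a]) z ↔ ∃ u, Spells E v x u ∧ (u, a, z) ∈ E := by
  induction x generalizing v with
  | nil =>
    constructor
    · rintro (_ | ⟨h, _ | _⟩)
      exact ⟨v, .nil v, h⟩
    · rintro ⟨u, _ | _, h⟩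
      exact .cons h (.nil _)
  | cons b x ih =>
    constructor
    · rintro (_ | ⟨h, h'⟩)
      obtain ⟨u, h1, h2⟩ := ih.1 h'
      exact ⟨u, .cons h h1, h2⟩
    · rintro ⟨u, _ | ⟨h, h'⟩, h2⟩
      exact .cons h (ih.2 ⟨u, h', h2⟩)

/-! ### Input words and the language as layered reachability -/

namespace DiverseInstance

variable (I : DiverseInstance)

/-- The input words. -/
def word (a : ℕ) : ℕ := I.encode.getD a 0

lemma encode_length : I.encode.length = 8 + 3 * I.edgeList.length := by
  have h : ∀ l : List (Fin I.numV × Fin I.numA × Fin I.numV),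
      (l.flatMap fun e => [(e.1 : ℕ), (e.2.1 : ℕ), (e.2.2 : ℕ)]).length = 3 * l.length := by
    intro l
    induction l with
    | nil => rfl
    | cons e l ih => rw [List.flatMap_cons, List.length_append, ih]; simp; ring
  rw [encode, List.length_append, h]
  simp

lemma word_edge (k : ℕ) (hk : k < I.edgeList.length) :
    I.word (8 + 3 * k) = (I.edgeList[k].1 : ℕ) ∧
    I.word (8 + 3 * k + 1) = (I.edgeList[k].2.1 : ℕ) ∧
    I.word (8 + 3 * k + 2) = (I.edgeList[k].2.2 : ℕ) := by
  have h : ∀ (l : List (Fin I.numV × Fin I.numA × Fin I.numV)) (k : ℕ) (hk : k < l.length)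
      (m : List ℕ), m = (l.flatMap fun e => [(e.1 : ℕ), (e.2.1 : ℕ), (e.2.2 : ℕ)]) →
      m.getD (3 * k) 0 = (l[k].1 : ℕ) ∧ m.getD (3 * k + 1) 0 = (l[k].2.1 : ℕ) ∧
      m.getD (3 * k + 2) 0 = (l[k].2.2 : ℕ) := by
    intro l
    induction l with
    | nil => simp
    | cons e l ih =>
      rintro (_ | k) hk m rfl
      · simp
      · exact ih k (by simpa using hk) _ rfl
  have h' := h I.edgeList k hk _ rfl
  have h8 : ∀ j, I.word (8 + j) =
      (I.edgeList.flatMap fun e => [(e.1 : ℕ), (e.2.1 : ℕ), (e.2.2 : ℕ)]).getD j 0 := by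
    intro j
    rw [add_comm]
    rfl
  simpa only [add_assoc, h8] using h'

/-- The tail of an edge. -/
def tl (k : ℕ) : ℕ := I.word (8 + 3 * k)

/-- The label of an edge. -/
def lb (k : ℕ) : ℕ := I.word (8 + 3 * k + 1)

/-- The head of an edge. -/
def hd (k : ℕ) : ℕ := I.word (8 + 3 * k + 2)

lemma tl_lt {k : ℕ} (hk : k < I.edgeList.length) : I.tl k < I.numV := by
  rw [tl, (I.word_edge k hk).1]
  exact Fin.is_lt _

lemma hd_lt {k : ℕ} (hk : k < I.edgeList.length) : I.hd k < I.numV := by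
  rw [hd, (I.word_edge k hk).2.2]
  exact Fin.is_lt _

/-- The language of an instance, with strings as functions on natural numbers of which only
the first `r` values matter. -/
def Lang (y : ℕ → ℕ) : Prop :=
  Reach I.edgeList.length I.tl I.lb I.hd I.G.s y I.r I.G.t

lemma reach_of_spells {x : List (Fin I.numA)} {u : Fin I.numV} (h : Spells I.G.edges I.G.s x u)
    {y : ℕ → ℕ} (hy : ∀ p (hp : p < x.length), y p = (x[p] : ℕ)) :
    Reach I.edgeList.length I.tl I.lb I.hd I.G.s y x.length u := by
  induction x using List.reverseRecOn generalizing u with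
  | nil =>
    cases h
    rfl
  | append_singleton x a ih =>
    obtain ⟨v, h1, h2⟩ := Spells.concat_iff.1 h
    rw [← I.mem_edgeList] at h2
    obtain ⟨k, hk, hkv⟩ := List.getElem_of_mem h2
    obtain ⟨w1, w2, w3⟩ := I.word_edge k hk
    rw [hkv] at w1 w2 w3
    rw [List.length_append, List.length_singleton]
    refine ⟨k, hk, ?_, ?_, w3⟩
    · rw [tl, w1]
      refine ih h1 fun p hp => ?_
      rw [hy p (by rw [List.length_append]; omega), List.getElem_append_left hp]
    · rw [lb, w2, hy _ (by simp)]
      simp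

lemma spells_of_reach {y : ℕ → ℕ} {i u : ℕ}
    (h : Reach I.edgeList.length I.tl I.lb I.hd I.G.s y i u) :
    ∃ (x : List (Fin I.numA)) (u' : Fin I.numV), (u' : ℕ) = u ∧ x.length = i ∧
      Spells I.G.edges I.G.s x u' ∧ ∀ p (hp : p < x.length), y p = (x[p] : ℕ) := by
  induction i generalizing u with
  | zero => exact ⟨[], I.G.s, h.symm, rfl, .nil _, by simp⟩
  | succ i ih =>
    obtain ⟨k, hk, h1, h2, h3⟩ := h
    obtain ⟨x, v, hv, hx, hs, hy⟩ := ih h1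
    obtain ⟨w1, w2, w3⟩ := I.word_edge k hk
    have he : I.edgeList[k] ∈ I.G.edges := (I.mem_edgeList _).1 (List.getElem_mem _)
    refine ⟨x ++ [I.edgeList[k].2.1], I.edgeList[k].2.2, ?_, by simp [hx],
      Spells.concat_iff.2 ⟨v, hs, ?_⟩, ?_⟩
    · rw [← h3, hd, w3]
    · have : v = I.edgeList[k].1 := Fin.ext (by rw [hv, tl, w1])
      rw [this]
      exact he
    · intro p hp
      rw [List.length_append, List.length_singleton] at hp
      by_cases hpx : p < x.length
      · rw [hy p hpx, List.getElem_append_left hpx]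
      · obtain rfl : p = i := by omega
        rw [← h2, lb, w2, List.getElem_append_right (by omega)]
        simp

lemma lang_of_mem {x : Fin I.r → Fin I.numA} (hx : List.ofFn x ∈ I.G.language) {y : ℕ → ℕ}
    (hy : ∀ p : Fin I.r, y p = (x p : ℕ)) : I.Lang y := by
  have := I.reach_of_spells hx (y := y) (fun p hp => by
    rw [List.getElem_ofFn]; exact hy ⟨p, _⟩)
  rwa [List.length_ofFn] at this

lemma exists_mem_of_lang {y : ℕ → ℕ} (h : I.Lang y) :
    ∃ x : Fin I.r → Fin I.numA, List.ofFn x ∈ I.G.language ∧ ∀ p : Fin I.r, y p = (x p : ℕ) := by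
  obtain ⟨x, u, hu, hl, hs, hy⟩ := I.spells_of_reach h
  rw [Fin.val_inj] at hu
  subst hu
  have hx : List.ofFn (fun p : Fin I.r => x[(p : ℕ)]'(hl.symm ▸ p.2)) = x := by
    apply List.ext_getElem
    · simp [hl]
    · simp
  refine ⟨fun p => x[(p : ℕ)]'(hl.symm ▸ p.2), ?_, fun p => hy p _⟩
  rw [hx]
  exact hs

/-- The sink is reachable from the source. Hence the root of the search tree always has a string,
which serves as fallback for the other nodes. -/
lemma exists_lang : ∃ y, I.Lang y := by
  obtain ⟨x, hx⟩ := (I.G.on_path I.G.t).1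
  have hl := I.length_eq x hx
  have := I.reach_of_spells hx (y := fun p => if h : p < x.length then (x[p] : ℕ) else 0)
    (fun p hp => by simp [hp])
  exact ⟨_, Eq.subst (motive := fun i => Reach _ _ _ _ _ _ i _) hl this⟩

/-- Every vertex except the source is the head of some edge. This bounds the width of the tables by
the input length. -/
lemma numV_le : I.numV ≤ I.edgeList.length + 1 := by
  classical
  have h : (Finset.univ : Finset (Fin I.numV)) ⊆
      insert I.G.s (I.edgeList.toFinset.image fun e => e.2.2) := by
    intro v _
    obtain ⟨x, hx⟩ := (I.G.on_path v).1
    rcases List.eq_nil_or_concat' x with rfl | ⟨x, a, rfl⟩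
    · cases hx
      exact Finset.mem_insert_self _ _
    · obtain ⟨u, -, h⟩ := Spells.concat_iff.1 hx
      exact Finset.mem_insert_of_mem (Finset.mem_image.2
        ⟨(u, a, v), List.mem_toFinset.2 ((I.mem_edgeList _).2 h), rfl⟩)
  have := Finset.card_le_card h
  rw [Finset.card_univ, Fintype.card_fin] at this
  refine this.trans ((Finset.card_insert_le _ _).trans (Nat.succ_le_succ ?_))
  exact Finset.card_image_le.trans (List.toFinset_card_le _)

end DiverseInstance

/-! ### Brute force over the search tree -/

/-- The Hamming distance of the first `r` symbols. -/
def prefixDist (r : ℕ) (y z : ℕ → ℕ) : ℕ := ∑ p ∈ Finset.range r, if y p = z p then 0 else 1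

lemma prefixDist_eq {r n : ℕ} {y z : ℕ → ℕ} {x x' : Fin r → Fin n}
    (hy : ∀ p : Fin r, y p = (x p : ℕ)) (hz : ∀ p : Fin r, z p = (x' p : ℕ)) :
    prefixDist r y z = hammingDist x x' := by
  rw [prefixDist, Finset.sum_range, hammingDist, Finset.card_filter]
  refine Finset.sum_congr rfl fun p _ => ?_
  rw [hy, hz]
  by_cases h : x p = x' p
  · simp [h]
  · simp [h, Fin.val_inj]

/-- The `i`-th digit of `c` in base `N`. -/
def digit (N c i : ℕ) : ℕ := c / N ^ i % N

/-- Horner's scheme: the first digit plus `N` times the number with the remaining digits. -/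
lemma exists_digit_eq {N : ℕ} (K : ℕ) (g : ℕ → ℕ) (hg : ∀ i < K, g i < N) :
    ∃ c < N ^ K, ∀ i < K, digit N c i = g i := by
  induction K generalizing g with
  | zero => exact ⟨0, by simp, by simp⟩
  | succ K ih =>
    obtain ⟨c, hc, h⟩ := ih (fun i => g (i + 1)) fun i hi => hg _ (by omega)
    have h0 := hg 0 (by omega)
    refine ⟨g 0 + N * c, ?_, ?_⟩
    · rw [pow_succ]
      nlinarith
    · rintro (_ | i) hi
      · simp [digit, Nat.mod_eq_of_lt h0]
      · rw [← h i (by omega), digit, digit, pow_succ', ← Nat.div_div_eq_div_mul,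
          Nat.add_mul_div_left _ _ (by omega), Nat.div_eq_of_lt h0, zero_add]

/-- The tuple of strings with the numbers that are the `K` digits of `c` is a solution. -/
def GoodTuple (r K N Δ : ℕ) (P : ℕ → ℕ → ℕ) (c : ℕ) : Prop :=
  (∀ i < K, ∀ j < i, prefixDist r (P (digit N c i)) (P (digit N c j)) ≠ 0) ∧
  Δ ≤ ∑ i ∈ Finset.range K, ∑ j ∈ Finset.range i,
    prefixDist r (P (digit N c i)) (P (digit N c j))

/-- The node strings form a representative set by `exists_node_avoiding`, so a solution can be
exchanged into it and enumerated as a tuple. Conversely, nonzero distances make the entries of a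
good tuple distinct, so they form a set of size K. -/
lemma DiverseInstance.isYes_iff (I : DiverseInstance) {N : ℕ} (hN : N = (I.r + 1) ^ (I.r * I.K))
    (P : ℕ → ℕ → ℕ) (hP : ∀ n < N, GoodNode I.r I.Lang P n) :
    I.IsYes ↔ ∃ c < N ^ I.K, GoodTuple I.r I.K N I.Δ P c := by
  have hN0 : 0 < N := hN ▸ Nat.pow_pos (Nat.succ_pos _)
  -- Beyond `N` nothing is known about `P n`; the root string is a default value there.
  have hx' : ∀ n, ∃ x : Fin I.r → Fin I.numA,
      n < N → List.ofFn x ∈ I.G.language ∧ ∀ p : Fin I.r, P n p = (x p : ℕ) := by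
    intro n
    by_cases hn : n < N
    · exact (I.exists_mem_of_lang (hP n hn).1).imp fun _ h _ => h
    · exact (I.exists_mem_of_lang (hP 0 hN0).1).imp fun _ _ h => absurd h hn
  choose x hx' using hx'
  have hxL := fun n hn => (hx' n hn).1
  have hx := fun n hn => (hx' n hn).2
  have hdig : ∀ c i, digit N c i < N := fun c i => Nat.mod_lt _ hN0
  have hdist : ∀ n < N, ∀ m < N, prefixDist I.r (P n) (P m) = hammingDist (x n) (x m) :=
    fun n hn m hm => prefixDist_eq (hx n hn) (hx m hm)
  constructor
  · rintro ⟨X, hXL, hXK, hXΔ⟩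
    have hker : ∀ F : Finset (Fin I.r × Fin I.numA), F.card ≤ I.r * I.K →
        (∃ x ∈ {x : Fin I.r → Fin I.numA | List.ofFn x ∈ I.G.language}, ∀ p, (p, x p) ∉ F) →
        ∃ z ∈ {z | ∃ n < N, z = x n}, ∀ p, (p, z p) ∉ F := by
      rintro F hF ⟨z, hz, hzF⟩
      let φ : Fin I.r × Fin I.numA → ℕ × ℕ := fun q => (q.1, q.2)
      have hφ : ∀ (p : Fin I.r) (a : Fin I.numA), ((p : ℕ), (a : ℕ)) ∈ F.image φ → (p, a) ∈ F := by
        intro p a h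
        obtain ⟨⟨p', a'⟩, h1, h2⟩ := Finset.mem_image.1 h
        simp only [φ, Prod.mk.injEq, Fin.val_inj] at h2
        rwa [h2.1, h2.2] at h1
      subst hN
      obtain ⟨n, hn, h⟩ := exists_node_avoiding hP (F.image φ) (Finset.card_image_le.trans hF)
        ⟨fun p => if h : p < I.r then (z ⟨p, h⟩ : ℕ) else 0, I.lang_of_mem hz (by simp), by
          intro p hp h
          simp only [hp, dif_pos] at h
          exact hzF ⟨p, hp⟩ (hφ ⟨p, hp⟩ _ h)⟩
      refine ⟨x n, ⟨n, hn, rfl⟩, fun p hp => h p p.2 ?_⟩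
      rw [hx n hn]
      exact Finset.mem_image.2 ⟨_, hp, rfl⟩
    obtain ⟨Y, hYR, hYK, hY⟩ := exists_diverse_subset (K := I.K)
      (L := {x | List.ofFn x ∈ I.G.language}) (R := {z | ∃ n < N, z = x n}) hker
      (by rintro z ⟨n, hn, rfl⟩; exact hxL n hn) X hXL hXK
    choose! g hg hxg using hYR
    let e := (Y.equivFinOfCardEq hYK).symm
    obtain ⟨c, hc, hcd⟩ := exists_digit_eq (N := N) I.K
      (fun i => if h : i < I.K then g (e ⟨i, h⟩) else 0) (fun i hi => by
        simp only [hi, dif_pos]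
        exact hg _ (e ⟨i, hi⟩).2)
    have hxe : ∀ i (hi : i < I.K), x (digit N c i) = e ⟨i, hi⟩ := by
      intro i hi
      rw [hcd i hi, dif_pos hi]
      exact (hxg _ (e ⟨i, hi⟩).2).symm
    have hne : ∀ i < I.K, ∀ j < i, x (digit N c i) ≠ x (digit N c j) := by
      intro i hi j hj h
      rw [hxe i hi, hxe j (hj.trans hi)] at h
      have := e.injective (Subtype.ext h)
      simp only [Fin.mk.injEq] at this
      omega
    refine ⟨c, hc, ?_, ?_⟩
    · intro i hi j hj
      rw [hdist _ (hdig _ _) _ (hdig _ _), hammingDist_ne_zero]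
      exact hne i hi j hj
    · simp only [hdist _ (hdig _ _) _ (hdig _ _)]
      obtain ⟨h1, h2⟩ := sumDiversity_image_range (fun i => x (digit N c i)) I.K hne
      rw [← h2]
      refine hXΔ.trans (hY.trans (le_of_eq ?_))
      congr 1
      -- The set of tuple entries lies in `Y` and both have K elements.
      refine (Finset.eq_of_subset_of_card_le ?_ (by rw [h1, hYK])).symm
      intro z hz
      obtain ⟨i, hi, rfl⟩ := Finset.mem_image.1 hz
      rw [hxe i (Finset.mem_range.1 hi)]
      exact (e _).2
  · rintro ⟨c, hc, h1, h2⟩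
    simp only [hdist _ (hdig _ _) _ (hdig _ _)] at h1 h2
    obtain ⟨h3, h4⟩ := sumDiversity_image_range (fun i => x (digit N c i)) I.K
      fun i hi j hj => hammingDist_ne_zero.1 (h1 i hi j hj)
    refine ⟨_, ?_, h3, h4 ▸ h2⟩
    intro z hz
    obtain ⟨i, -, rfl⟩ := Finset.mem_image.1 hz
    exact hxL _ (hdig _ _)

namespace WordRAM

open Term Program

local infixl:65 " +ₜ " => Term.op BinOp.add
local infixl:65 " -ₜ " => Term.op BinOp.sub
local infixl:70 " *ₜ " => Term.op BinOp.mul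
local infixl:70 " /ₜ " => Term.op BinOp.div
local infixl:70 " %ₜ " => Term.op BinOp.mod
local infixl:50 " =ₜ " => Term.op BinOp.eq
local infixl:50 " <ₜ " => Term.op BinOp.lt
local infixr:40 " ;; " => Program.seq
local infix:45 " ≔ " => Program.assign

attribute [local simp] Term.Safe Term.val BinOp.Safe BinOp.nat Term.cost

/-! ### Forbidden symbols -/

/-- The strings that stand in memory at distance `D` from each other, from address `b` on. -/
def pool (b D : ℕ) (mem : ℕ → ℕ) (n p : ℕ) : ℕ := mem (b + n * D + p)

/-- Set register 19 to whether the symbol in register 18 is forbidden at the position in register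
15 at the node in register 12. -/
def blockedProg : Program :=
  19 ≔ const 0 ;;
  20 ≔ reg 12 ;;
  loop (reg 20)
    (21 ≔ (reg 20 -ₜ const 1) /ₜ reg 2 ;;
     22 ≔ (reg 20 -ₜ const 1) %ₜ reg 2 ;;
     (branch (reg 22 =ₜ reg 15)
       (branch (read (reg 8 +ₜ reg 21 *ₜ reg 11 +ₜ reg 22) =ₜ reg 18) (19 ≔ const 1) skip)
       skip) ;;
     20 ≔ reg 21)

/-- The loop climbs from `n` to the root, passing from a node k + 1 to its parent k / r and
comparing with the one pair that this tree edge forbids. A bound linear in `n` is enough, since the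
tree size depends only on the parameters. -/
lemma ok_blockedProg {w r b D n : ℕ} {S : NState} (hw : 1 < 2 ^ w) (hr : 0 < r) (hrD : r ≤ D)
    (h2 : S.reg 2 = r) (h8 : S.reg 8 = b) (h11 : S.reg 11 = D) (h12 : S.reg 12 = n)
    (hB : b + n * D < 2 ^ w) :
    Ok w blockedProg S ((n + 1) * 60) fun S' => S'.mem = S.mem ∧ (∀ j < 19, S'.reg j = S.reg j) ∧
      (S'.reg 19 ≠ 0 ↔ (S.reg 15, S.reg 18) ∈ forbidden r (pool b D S.mem) n) := by
  refine (ok_assign_seq (by simp) (ok_assign_seq (by simp)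
    -- Invariant: the pair is forbidden at `n` iff the flag is already raised or the pair is
    -- forbidden at the current node. At the root the second alternative is void. The measure is the
    -- number of the current node.
    (ok_loop (fun m S' => m = S'.reg 20 ∧ S'.reg 20 ≤ n ∧ S'.mem = S.mem ∧
      (∀ j < 19, S'.reg j = S.reg j) ∧
      ((S'.reg 19 ≠ 0 ∨ (S.reg 15, S.reg 18) ∈ forbidden r (pool b D S.mem) (S'.reg 20)) ↔
        (S.reg 15, S.reg 18) ∈ forbidden r (pool b D S.mem) n)) 50 ?_ ?_ ?_ n _ ?_))).time ?_
  · simp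
  · rintro m S' ⟨-, -, h1, h2, h3⟩ h4
    simp only [Term.val] at h4
    refine ⟨h1, h2, ?_⟩
    rw [← h3, h4, forbidden_zero]
    simp
  · rintro m S' ⟨hm, hn, hmem, hf, hi⟩ h0
    simp only [Term.val] at h0
    obtain ⟨k, hk⟩ : ∃ k, S'.reg 20 = k + 1 := ⟨_, (Nat.succ_pred_eq_of_ne_zero h0).symm⟩
    have hkd : k / r ≤ k := Nat.div_le_self _ _
    have hkm : k % r < r := Nat.mod_lt _ hr
    have hD : (k / r + 1) * D ≤ n * D := Nat.mul_le_mul_right _ (by omega)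
    have hD' : (k / r + 1) * D = k / r * D + D := by ring
    have e2 := (hf 2 (by norm_num)).trans h2
    have e8 := (hf 8 (by norm_num)).trans h8
    have e11 := (hf 11 (by norm_num)).trans h11
    have e15 := hf 15 (by norm_num)
    have e18 := hf 18 (by norm_num)
    rw [hk, forbidden_succ, Finset.mem_insert, Prod.mk.injEq] at hi
    refine (ok_assign_seq (by simp [hk, hw]) (ok_assign_seq (by simp [hk, hw])
      (Ok.seq (T₂ := 2) (R := fun S'' => S''.mem = S.mem ∧ (∀ j < 19, S''.reg j = S.reg j) ∧
        S''.reg 21 = k / r ∧ (S''.reg 19 ≠ 0 ↔ S'.reg 19 ≠ 0 ∨ (S.reg 15 = k % r ∧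
          S.reg 18 = pool b D S.mem (k / r) (k % r))))
        (ok_branch (T₁ := 17) (T₂ := 1) ?_ ?_ ?_) ?_))).time ?_
    · simp
    · intro hb
      simp [hk, e2, e15] at hb
      refine (ok_branch (T₁ := 2) (T₂ := 1) ?_ ?_ ?_).time ?_
      · simp [hk, e2, e8, e11]
        omega
      · intro hc
        simp [hk, e2, e8, e11, e18, hmem] at hc
        rw [hb] at hc
        refine ok_assign (by simpa using hw) ?_
        simpa [hmem, hk, e2, pool, hc, hb] using hf
      · intro hc
        simp [hk, e2, e8, e11, e18, hmem] at hc
        rw [hb] at hc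
        refine ok_skip ?_
        simpa [hmem, hk, e2, hb, Ne.symm hc, pool] using hf
      · simp
    · intro hb
      simp [hk, e2, e15] at hb
      refine ok_skip ?_
      simpa [hmem, hk, e2, Ne.symm hb, pool] using hf
    · rintro S'' ⟨g1, g2, g3, g4⟩
      refine ok_assign (by simp) ?_
      simp only [Term.val, g3]
      refine ⟨k / r, by omega, by simp, by simp; omega, by simpa using g1, by simpa using g2, ?_⟩
      · simp [hi.symm, g4, or_assoc]
    · simp
  · simp [h12]
  · simp
    omega

/-! ### The table of reachable vertices -/

/-- The table from address `c` on, whose cell for the layer `i` and the vertex `u` is nonzero only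
if some path of length `i` from the source to `u` avoids `F`; cells in layers above `0` hold the
address of the last edge of such a path. The edges have been processed for the layers below `i`,
and the first `k` edges for the layer `i`. -/
structure TableInv (I : DiverseInstance) (F : Finset (ℕ × ℕ)) (c i k : ℕ) (mem : ℕ → ℕ) :
    Prop where
  zero : ∀ u < I.numV, mem (c + u) ≠ 0 ↔ u = I.G.s
  sound : ∀ j < I.r, ∀ u < I.numV, mem (c + (j + 1) * I.numV + u) ≠ 0 →
    ∃ e < I.edgeList.length, mem (c + (j + 1) * I.numV + u) = 8 + 3 * e ∧ I.hd e = u ∧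
      (j, I.lb e) ∉ F ∧ mem (c + j * I.numV + I.tl e) ≠ 0
  complete : ∀ j e, e < I.edgeList.length → j < i ∨ j = i ∧ e < k →
    mem (c + j * I.numV + I.tl e) ≠ 0 → (j, I.lb e) ∉ F →
      mem (c + (j + 1) * I.numV + I.hd e) ≠ 0

namespace TableInv

variable {I : DiverseInstance} {F : Finset (ℕ × ℕ)} {c i k : ℕ} {mem : ℕ → ℕ}

/-- Division with remainder by the row width recovers the layer and the vertex. -/
lemma cell_inj {V i j u v : ℕ} (hu : u < V) (hv : v < V) (h : i * V + u = j * V + v) :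
    i = j ∧ u = v := by
  have h1 : (i * V + u) / V = i := by
    rw [mul_comm, Nat.mul_add_div (by omega), Nat.div_eq_of_lt hu, add_zero]
  have h2 : (j * V + v) / V = j := by
    rw [mul_comm, Nat.mul_add_div (by omega), Nat.div_eq_of_lt hv, add_zero]
  have : i = j := by rw [← h1, h, h2]
  subst this
  exact ⟨rfl, by omega⟩

lemma skip (h : TableInv I F c i k mem)
    (hs : mem (c + i * I.numV + I.tl k) = 0 ∨ (i, I.lb k) ∈ F) : TableInv I F c i (k + 1) mem := by
  refine ⟨h.zero, h.sound, fun j e he hj h1 h2 => ?_⟩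
  by_cases hje : j = i ∧ e = k
  · obtain ⟨rfl, rfl⟩ := hje
    exact (hs.elim h1 h2).elim
  · exact h.complete j e he (by omega) h1 h2

lemma next (h : TableInv I F c i I.edgeList.length mem) : TableInv I F c (i + 1) 0 mem :=
  ⟨h.zero, h.sound, fun j e he hj => h.complete j e he (by omega)⟩

lemma congr (h : TableInv I F c i k mem) {mem' : ℕ → ℕ} (hm : ∀ a, c ≤ a → mem' a = mem a) :
    TableInv I F c i k mem' := by
  have h0 : ∀ u, mem' (c + u) = mem (c + u) := fun u => hm _ (by omega)
  have h1 : ∀ j u, mem' (c + j * I.numV + u) = mem (c + j * I.numV + u) :=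
    fun j u => hm _ (by omega)
  exact ⟨by simpa only [h0] using h.zero, by simpa only [h1] using h.sound,
    by simpa only [h1] using h.complete⟩

/-- The write affects only layer `i + 1`, whose outgoing edges are not yet covered by completeness,
so no new obligation arises. It keeps nonzero cells nonzero because edge addresses start at 8, so
older backward links remain valid. -/
lemma write (h : TableInv I F c i k mem) (hi : i < I.r) (hk : k < I.edgeList.length)
    (h1 : mem (c + i * I.numV + I.tl k) ≠ 0) (h2 : (i, I.lb k) ∉ F) :
    TableInv I F c i (k + 1)
      (Function.update mem (c + (i + 1) * I.numV + I.hd k) (8 + 3 * k)) := by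
  set mem' := Function.update mem (c + (i + 1) * I.numV + I.hd k) (8 + 3 * k) with hmem'
  have hne : ∀ j u, u < I.numV → ¬ (j = i + 1 ∧ u = I.hd k) →
      mem' (c + j * I.numV + u) = mem (c + j * I.numV + u) := by
    intro j u hu hju
    rw [hmem', Function.update_of_ne]
    intro h'
    exact hju (cell_inj hu (I.hd_lt hk) (by omega))
  have hmono : ∀ j u, u < I.numV → mem (c + j * I.numV + u) ≠ 0 →
      mem' (c + j * I.numV + u) ≠ 0 := by
    intro j u hu h'
    rw [hmem', Function.update_apply]
    split_ifs
    · omega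
    · exact h'
  have hself : mem' (c + (i + 1) * I.numV + I.hd k) = 8 + 3 * k := by
    rw [hmem', Function.update_self]
  refine ⟨?_, ?_, ?_⟩
  · intro u hu
    have := hne 0 u hu (by omega)
    rw [zero_mul, add_zero] at this
    rw [this]
    exact h.zero u hu
  · intro j hj u hu hju
    by_cases hc : j + 1 = i + 1 ∧ u = I.hd k
    · obtain ⟨hc, rfl⟩ := hc
      obtain rfl : j = i := by omega
      exact ⟨k, hk, hself, rfl, h2, hmono _ _ (I.tl_lt hk) h1⟩
    · rw [hne _ _ hu hc] at hju ⊢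
      obtain ⟨e, he, g1, g2, g3, g4⟩ := h.sound j hj u hu hju
      exact ⟨e, he, g1, g2, g3, hmono _ _ (I.tl_lt he) g4⟩
  · intro j e he hj g1 g2
    rw [hne _ _ (I.tl_lt he) (by omega)] at g1
    by_cases hc : j = i ∧ e = k
    · obtain ⟨rfl, rfl⟩ := hc
      rw [hself]
      omega
    · exact hmono _ _ (I.hd_lt he) (h.complete j e he (by omega) g1 g2)

/-- Once all layers are processed, completeness carries nonzero cells along any path that avoids
`F`. -/
lemma ne_zero_of_reach (h : TableInv I F c I.r 0 mem) {y : ℕ → ℕ} {j u : ℕ} (hj : j ≤ I.r)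
    (hy : Reach I.edgeList.length I.tl I.lb I.hd I.G.s y j u) (hF : ∀ p < j, (p, y p) ∉ F) :
    mem (c + j * I.numV + u) ≠ 0 := by
  induction j generalizing u with
  | zero =>
    cases hy
    rw [zero_mul, add_zero]
    exact (h.zero _ (Fin.is_lt _)).2 rfl
  | succ j ih =>
    obtain ⟨e, he, h1, h2, rfl⟩ := hy
    refine h.complete j e he (by omega) (ih (by omega) h1 fun p hp => hF p (by omega)) ?_
    rw [h2]
    exact hF j (by omega)

end TableInv

/-- The size of the memory block for a node of the search tree. -/
def stride (I : DiverseInstance) : ℕ := I.r + (I.r + 1) * I.numV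

/-- The first address after the input. -/
def base (I : DiverseInstance) : ℕ := 8 + 3 * I.edgeList.length

/-- The number of nodes of the search tree. -/
def treeSize (I : DiverseInstance) : ℕ := (I.r + 1) ^ (I.r * I.K)

/-- The registers 1 to 11 hold the parameters of the instance, and the input is in memory. -/
structure Ctx (I : DiverseInstance) (S : NState) : Prop where
  K : S.reg 1 = I.K
  r : S.reg 2 = I.r
  Δ : S.reg 3 = I.Δ
  V : S.reg 4 = I.numV
  s : S.reg 5 = I.G.s
  t : S.reg 6 = I.G.t
  E : S.reg 7 = I.edgeList.length
  b : S.reg 8 = base I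
  N : S.reg 9 = treeSize I
  M : S.reg 10 = treeSize I ^ I.K
  D : S.reg 11 = stride I
  word : ∀ a < base I, S.mem a = I.word a

lemma Ctx.frame {I : DiverseInstance} {S S' : NState} (h : Ctx I S)
    (hr : ∀ j < 12, 0 < j → S'.reg j = S.reg j) (hm : ∀ a < base I, S'.mem a = S.mem a) : Ctx I S' := by
  have hr' : ∀ j v, j < 12 → 0 < j → S.reg j = v → S'.reg j = v :=
    fun j v h1 h2 h3 => (hr j h1 h2).trans h3
  constructor
  case word => exact fun a ha => (hm a ha).trans (h.word a ha)
  all_goals refine hr' _ _ (by norm_num) (by norm_num) ?_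
  exacts [h.K, h.r, h.Δ, h.V, h.s, h.t, h.E, h.b, h.N, h.M, h.D]

lemma Ctx.edge {I : DiverseInstance} {S : NState} (h : Ctx I S) {k : ℕ}
    (hk : k < I.edgeList.length) : S.mem (8 + 3 * k) = I.tl k ∧ S.mem (8 + 3 * k + 1) = I.lb k ∧
      S.mem (8 + 3 * k + 2) = I.hd k :=
  ⟨h.word _ (by unfold base; omega), h.word _ (by unfold base; omega),
    h.word _ (by unfold base; omega)⟩

/-- Process the edge with the number in register 16 for the layer in register 15. -/
def relaxProg : Program :=
  17 ≔ const 8 +ₜ const 3 *ₜ reg 16 ;;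
  18 ≔ read (reg 17 +ₜ const 1) ;;
  branch (read (reg 14 +ₜ reg 15 *ₜ reg 4 +ₜ read (reg 17)))
    (blockedProg ;;
     branch (reg 19) skip
       (write (reg 14 +ₜ (reg 15 +ₜ const 1) *ₜ reg 4 +ₜ read (reg 17 +ₜ const 2)) (reg 17)))
    skip

lemma ok_relaxProg {w n i k c : ℕ} {I : DiverseInstance} {F : Finset (ℕ × ℕ)} {S : NState}
    (hS : Ctx I S) (h12 : S.reg 12 = n) (hc : c = base I + n * stride I + I.r)
    (hw : base I + (n + 1) * stride I < 2 ^ w)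
    (h14 : S.reg 14 = c) (h15 : S.reg 15 = i) (h16 : S.reg 16 = k)
    (hi : i < I.r) (hk : k < I.edgeList.length)
    (hF : F = forbidden I.r (pool (base I) (stride I) S.mem) n) (hT : TableInv I F c i k S.mem) :
    Ok w relaxProg S ((n + 1) * 120) fun S' => (∀ j < 17, S'.reg j = S.reg j) ∧
      TableInv I F c i (k + 1) S'.mem ∧
      ∀ a, a < c ∨ c + (I.r + 1) * I.numV ≤ a → S'.mem a = S.mem a := by
  have hb8 : base I = 8 + 3 * I.edgeList.length := rfl
  have hw1 : 8 < 2 ^ w := by omega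
  have hw0 : w ≠ 0 := by
    rintro rfl
    omega
  -- A node's block consists of r cells for its string followed by the table with r + 1 rows.
  have hD : (n + 1) * stride I = n * stride I + I.r + (I.r + 1) * I.numV := by
    unfold stride
    ring
  have hV : (i + 1) * I.numV + I.numV ≤ (I.r + 1) * I.numV := by
    rw [← Nat.succ_mul]
    exact Nat.mul_le_mul_right _ (by omega)
  have hV' : i * I.numV + I.numV = (i + 1) * I.numV := by ring
  have htl := I.tl_lt hk
  have hhd := I.hd_lt hk
  obtain ⟨e1, e2, e3⟩ := hS.edge hk
  refine (ok_assign_seq ?_ (ok_assign_seq ?_ (ok_branch (T₁ := (n + 1) * 60 + 20) (T₂ := 1)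
    ?_ ?_ ?_))).time ?_
  · simp [h16]
    omega
  · simp [h16]
    omega
  · simp [h16, h14, h15, hS.V, e1]
    omega
  · intro h
    simp [h16, h14, h15, hS.V, e1] at h
    refine (Ok.seq (T₂ := 17) (ok_blockedProg (r := I.r) (b := base I) (D := stride I) (n := n)
      (by omega) (by omega) (Nat.le_add_right _ _) (by simpa using hS.r) (by simpa using hS.b)
      (by simpa using hS.D) (by simpa using h12) (by omega)) ?_).time (by omega)
    rintro S' ⟨g1, g2, g3⟩
    have f4 := g2 4 (by norm_num)
    have f14 := g2 14 (by norm_num)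
    have f15 := g2 15 (by norm_num)
    have f17 := g2 17 (by norm_num)
    simp [hS.V, h14, h15, h16] at f4 f14 f15 f17
    simp [h15, h16, e2, ← hF] at g1 g3
    have hf : ∀ j < 17, S'.reg j = S.reg j := by
      intro j hj
      rw [g2 j (by omega)]
      simp [show j ≠ 18 by omega, show j ≠ 17 by omega]
    refine (ok_branch (T₁ := 1) (T₂ := 14) ?_ ?_ ?_).time (by simp only [Term.cost]; omega)
    · simp
    · intro h'
      exact ok_skip ⟨hf, g1 ▸ hT.skip (Or.inr (g3.1 h')), fun a _ => by rw [g1]⟩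
    · intro h'
      change S'.reg 19 = 0 at h'
      have h2 : (i, I.lb k) ∉ F := fun h2 => g3.2 h2 h'
      refine (ok_write ?_ ?_ ?_).time (by simp)
      · simp [f4, f14, f15, f17, g1, e3]
        omega
      · simp
      · simp [f4, f14, f15, f17, g1, e3]
        refine ⟨hf, ?_, ?_⟩
        · rw [NState.wr, g1]
          exact hT.write hi hk h h2
        · intro a ha
          rw [NState.wr_mem, g1, if_neg]
          omega
  · intro h
    simp [h16, h14, h15, hS.V, e1] at h
    refine ok_skip ⟨?_, hT.skip (Or.inl h), by simp⟩
    intro j hj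
    simp [show j ≠ 18 by omega, show j ≠ 17 by omega]
  · simp
    omega

/-! ### Processing a node of the search tree -/

/-- Fill the table for the node in register 12. -/
def searchProg : Program :=
  13 ≔ reg 8 +ₜ reg 12 *ₜ reg 11 ;;
  14 ≔ reg 13 +ₜ reg 2 ;;
  write (reg 14 +ₜ reg 5) (const 1) ;;
  forLoop 15 2 (forLoop 16 7 relaxProg)

/-- For r = 0 only the root is considered, where the forbidden set is empty; otherwise
`forbidden_congr` applies. -/
lemma goodNode_congr {I : DiverseInstance} {P P' : ℕ → ℕ → ℕ} {n : ℕ}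
    (hn : I.r = 0 → n = 0) (h : ∀ m ≤ n, ∀ p < I.r, P m p = P' m p)
    (hP : GoodNode I.r I.Lang P n) : GoodNode I.r I.Lang P' n := by
  have hf : forbidden I.r P n = forbidden I.r P' n := by
    rcases Nat.eq_zero_or_pos I.r with h0 | h0
    · rw [hn h0, forbidden_zero, forbidden_zero]
    · exact forbidden_congr h0 n fun m hm => h m hm.le
  refine ⟨Reach.congr hP.1 (h n le_rfl), fun hy p hp => ?_⟩
  rw [← hf] at hy ⊢
  rw [← h n le_rfl p hp]
  exact hP.2 hy p hp

/-- The start of the table in the memory block of a node. -/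
def tableAddr (I : DiverseInstance) (n : ℕ) : ℕ := base I + n * stride I + I.r

lemma pool_lt {I : DiverseInstance} {n m p : ℕ} (hm : m < n) (hp : p < I.r) :
    base I + m * stride I + p < base I + n * stride I := by
  have h : (m + 1) * stride I ≤ n * stride I := Nat.mul_le_mul_right _ hm
  have hs : I.r ≤ stride I := Nat.le_add_right _ _
  rw [Nat.succ_mul] at h
  omega

lemma forbidden_pool_congr {I : DiverseInstance} {n : ℕ} (hn : I.r = 0 → n = 0)
    {mem mem' : ℕ → ℕ} (h : ∀ a < base I + n * stride I, mem' a = mem a) :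
    forbidden I.r (pool (base I) (stride I) mem') n =
      forbidden I.r (pool (base I) (stride I) mem) n := by
  rcases Nat.eq_zero_or_pos I.r with h0 | h0
  · rw [hn h0, forbidden_zero, forbidden_zero]
  · exact forbidden_congr h0 n fun m hm p hp => h _ (pool_lt hm hp)

lemma ok_searchProg {w n : ℕ} {I : DiverseInstance} {F : Finset (ℕ × ℕ)} {S : NState}
    (hS : Ctx I S) (h12 : S.reg 12 = n) (hn : I.r = 0 → n = 0)
    (hw : base I + (n + 1) * stride I < 2 ^ w)
    (hF : F = forbidden I.r (pool (base I) (stride I) S.mem) n)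
    (h0 : ∀ a, base I + n * stride I ≤ a → S.mem a = 0) :
    Ok w searchProg S (100 + (I.r + 1) * ((I.edgeList.length + 1) * ((n + 1) * 120 + 10) + 10))
      fun S' => (∀ j < 13, S'.reg j = S.reg j) ∧ S'.reg 13 = base I + n * stride I ∧
        S'.reg 14 = tableAddr I n ∧ TableInv I F (tableAddr I n) I.r 0 S'.mem ∧
        ∀ a, a < tableAddr I n ∨ base I + (n + 1) * stride I ≤ a → S'.mem a = S.mem a := by
  have hb8 : base I = 8 + 3 * I.edgeList.length := rfl
  have hw1 : 8 < 2 ^ w := by omega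
  have hw0 : w ≠ 0 := by
    rintro rfl
    omega
  have hD : (n + 1) * stride I = n * stride I + I.r + (I.r + 1) * I.numV := by
    unfold stride
    ring
  have hV : (I.r + 1) * I.numV = I.r * I.numV + I.numV := by ring
  have hs : (I.G.s : ℕ) < I.numV := I.G.s.2
  have hend : tableAddr I n + (I.r + 1) * I.numV = base I + (n + 1) * stride I := by
    unfold tableAddr
    omega
  have hc : tableAddr I n = base I + n * stride I + I.r := rfl
  set c := tableAddr I n
  -- The block is zero except for the source in layer 0, so there are no backward links to justify.
  -- Completeness is vacuous because no edge has been processed.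
  have hinit : TableInv I F c 0 0 (Function.update S.mem (c + I.G.s) 1) := by
    refine ⟨?_, ?_, ?_⟩
    · intro u _
      rw [Function.update_apply]
      split_ifs with h
      · simp
        omega
      · rw [h0 _ (by omega)]
        simp
        omega
    · intro j _ u hu h
      have h1 : (j + 1) * I.numV = j * I.numV + I.numV := by ring
      rw [Function.update_of_ne (by omega), h0 _ (by omega)] at h
      exact absurd rfl h
    · intro j e _ h
      omega
  refine (ok_assign_seq ?_ (ok_assign_seq ?_ (ok_write_seq ?_ ?_ ?_))).time (T₁ :=
    (5 + 1 + (3 + 1 + (3 + 1 + 1 +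
      ((I.r + 1) * ((I.edgeList.length + 1) * ((n + 1) * 120 + 10) + 10)))))) (by omega)
  · simp [hS.b, hS.D, h12]
    omega
  · simp [hS.b, hS.D, hS.r, h12]
    omega
  · simp [hS.b, hS.D, hS.r, hS.s, h12]
    omega
  · simp
    omega
  · simp [hS.b, hS.D, hS.r, hS.s, h12]
    rw [← hc]
    refine ok_for (by norm_num) (fun i S' => (∀ j < 13, S'.reg j = S.reg j) ∧
      S'.reg 13 = base I + n * stride I ∧ S'.reg 14 = c ∧ TableInv I F c i 0 S'.mem ∧
      ∀ a, a < c ∨ base I + (n + 1) * stride I ≤ a → S'.mem a = S.mem a) I.r _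
      (by simp [hS.r]) (by omega) (by omega) ?_ ?_ ?_
    · simp
      refine ⟨hinit, fun a ha => ?_⟩
      rw [NState.wr_mem, if_neg]
      rfl
      omega
    · rintro i S₁ hi h15 h2 ⟨f1, f2, f3, f4, f5⟩
      have hS₁ : Ctx I S₁ := hS.frame (fun j hj _ => f1 j (by omega)) fun a ha => f5 a (by omega)
      refine ok_for (by norm_num) (fun k S' => (∀ j < 16, S'.reg j = S₁.reg j) ∧
        TableInv I F c i k S'.mem ∧
        ∀ a, a < c ∨ base I + (n + 1) * stride I ≤ a → S'.mem a = S.mem a) I.edgeList.length _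
        hS₁.E (by omega) (by omega) ?_ ?_ ?_
      · simpa using ⟨f4, f5⟩
      · rintro k S₂ hk h16 h7 ⟨g1, g2, g3⟩
        have hS₂ : Ctx I S₂ := hS₁.frame (fun j hj _ => g1 j (by omega))
          fun a ha => (g3 a (by omega)).trans (f5 a (by omega)).symm
        refine (ok_relaxProg (F := F) hS₂ (n := n) ?_ hc hw ?_ ?_ h16 hi hk ?_ g2).mono le_rfl ?_
        · rw [g1 12 (by norm_num), f1 12 (by norm_num), h12]
        · rw [g1 14 (by norm_num), f3]
        · rw [g1 15 (by norm_num), h15]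
        -- Only the table of node `n` has been written, so the strings of earlier nodes still define
        -- the same `F`.
        · rw [hF]
          exact (forbidden_pool_congr hn fun a ha => g3 a (by omega)).symm
        · rintro S₃ ⟨k1, k2, k3⟩
          refine ⟨(k1 16 (by norm_num)).trans h16, (k1 7 (by norm_num)).trans h7, ?_⟩
          simp only [NState.set_mem, NState.set_reg]
          refine ⟨?_, k2, ?_⟩
          · intro j hj
            rw [if_neg (by omega), k1 j (by omega), g1 j hj]
          · intro a ha
            rw [k3 a (by omega), g3 a ha]
      · rintro S₂ ⟨g1, g2, g3⟩
        refine ⟨(g1 15 (by norm_num)).trans h15, (g1 2 (by norm_num)).trans h2, ?_⟩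
        simp
        refine ⟨fun j hj => ?_, ?_, ?_, g2.next, g3⟩
        · rw [g1 j (by omega), f1 j hj]
        · rw [g1 13 (by norm_num), f2]
        · rw [g1 14 (by norm_num), f3]
    · exact fun _ h => h

/-- Write the string for the node in register 12 to memory. -/
def extractProg : Program :=
  branch (read (reg 14 +ₜ reg 2 *ₜ reg 4 +ₜ reg 6))
    (15 ≔ reg 6 ;;
     forLoop 16 2
       (17 ≔ read (reg 14 +ₜ (reg 2 -ₜ reg 16) *ₜ reg 4 +ₜ reg 15) ;;
        write (reg 13 +ₜ (reg 2 -ₜ reg 16 -ₜ const 1)) (read (reg 17 +ₜ const 1)) ;;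
        15 ≔ read (reg 17)))
    (forLoop 16 2 (write (reg 13 +ₜ reg 16) (read (reg 8 +ₜ reg 16))))

/-- If the sink is reached in layer r, the stored edges lead back to the source and their labels,
written from the last position to the first, spell a string avoiding `F`. Otherwise no string of the
language avoids `F`, and a copy of the root string satisfies the condition. -/
lemma ok_extractProg {w n : ℕ} {I : DiverseInstance} {F : Finset (ℕ × ℕ)} {S : NState}
    (hS : Ctx I S) (hn : I.r = 0 → n = 0)
    (hw : base I + (n + 1) * stride I < 2 ^ w) (h13 : S.reg 13 = base I + n * stride I)
    (h14 : S.reg 14 = tableAddr I n)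
    (hF : F = forbidden I.r (pool (base I) (stride I) S.mem) n)
    (hT : TableInv I F (tableAddr I n) I.r 0 S.mem)
    (hP : ∀ m < n, GoodNode I.r I.Lang (pool (base I) (stride I) S.mem) m) :
    Ok w extractProg S (100 + (I.r + 1) * 100)
      fun S' => (∀ j < 13, S'.reg j = S.reg j) ∧
        (∀ a, a < base I + n * stride I ∨ base I + (n + 1) * stride I ≤ a → S'.mem a = S.mem a) ∧
        GoodNode I.r I.Lang (pool (base I) (stride I) S'.mem) n := by
  have hb8 : base I = 8 + 3 * I.edgeList.length := rfl
  have hw1 : 8 < 2 ^ w := by omega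
  have hw0 : w ≠ 0 := by
    rintro rfl
    omega
  have hD : (n + 1) * stride I = n * stride I + I.r + (I.r + 1) * I.numV := by
    unfold stride
    ring
  have hV : (I.r + 1) * I.numV = I.r * I.numV + I.numV := by ring
  have ht : (I.G.t : ℕ) < I.numV := I.G.t.2
  have hc : tableAddr I n = base I + n * stride I + I.r := rfl
  set c := tableAddr I n
  refine (ok_branch (T₁ := 10 + (I.r + 1) * 60) (T₂ := (I.r + 1) * 20) ?_ ?_ ?_).time
    (by simp only [Term.cost]; omega)
  · simp [h14, hS.r, hS.V, hS.t]
    omega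
  · intro h
    simp [h14, hS.r, hS.V, hS.t] at h
    refine (ok_assign_seq (T := (I.r + 1) * (50 + 10)) (by simp) ?_).time
      (by simp only [Term.cost]; omega)
    -- After k backward steps, any path of length r − k to the current vertex is completed to a word
    -- of the language by the symbols already written, none of which is forbidden.
    refine ok_for (by norm_num) (fun k S' => (∀ j < 15, S'.reg j = S.reg j) ∧
      S'.reg 15 < I.numV ∧ S'.mem (c + (I.r - k) * I.numV + S'.reg 15) ≠ 0 ∧
      (∀ a, a < base I + n * stride I ∨ c ≤ a → S'.mem a = S.mem a) ∧
      (∀ y, Reach I.edgeList.length I.tl I.lb I.hd I.G.s y (I.r - k) (S'.reg 15) →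
        (∀ p < I.r, I.r - k ≤ p → y p = S'.mem (base I + n * stride I + p)) → I.Lang y) ∧
      (∀ p < I.r, I.r - k ≤ p → (p, S'.mem (base I + n * stride I + p)) ∉ F))
      I.r _ (by simp [hS.r]) (by omega) (by omega) ?_ ?_ ?_
    · simp [hS.t]
      exact ⟨h, fun y hy _ => hy, fun p hp hp' => by omega⟩
    · rintro k S₁ hk h16 h2 ⟨f1, f2, f3, f4, f5, f6⟩
      have hS₁ : Ctx I S₁ := hS.frame (fun j hj _ => f1 j (by omega)) fun a ha => f4 a (by omega)
      obtain ⟨q, hq⟩ : ∃ q, I.r - k = q + 1 := ⟨I.r - k - 1, by omega⟩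
      have hq' : I.r - (k + 1) = q := by omega
      have hqr : q < I.r := by omega
      rw [hq] at f3 f5 f6
      rw [hq']
      have hT₁ := hT.congr (mem' := S₁.mem) fun a ha => f4 a (Or.inr ha)
      obtain ⟨e, he, t1, t2, t3, t4⟩ := hT₁.sound q hqr _ f2 f3
      obtain ⟨e1, e2, -⟩ := hS₁.edge he
      have h13' := (f1 13 (by norm_num)).trans h13
      have h14' := (f1 14 (by norm_num)).trans h14
      have hqV : (q + 1) * I.numV ≤ I.r * I.numV := Nat.mul_le_mul_right _ hqr
      refine (ok_assign_seq ?_ (ok_write_seq ?_ ?_ (ok_assign (Q := fun S' => _) ?_ ?_))).time ?_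
      · simp [hS₁.r, hS₁.V, h16, h14', hq]
        omega
      · simp [hS₁.r, hS₁.V, h16, h14', hq, h13', t1]
        omega
      · simp [hS₁.r, hS₁.V, h16, h14', hq, t1]
        omega
      · simp
      · have hne : 8 + 3 * e ≠ base I + n * stride I + q := by omega
        simp [hS₁.r, hS₁.V, h16, h14', hq, h13', t1, e2, NState.wr_mem, hne, e1]
        refine ⟨f1, I.tl_lt he, ?_, ?_, ?_, ?_⟩
        · rw [if_neg (by omega)]
          exact t4
        · intro a ha
          rw [if_neg (by omega), f4 a ha]
        · intro y hy hyp
          have hyq := hyp q hqr le_rfl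
          rw [if_pos rfl] at hyq
          refine f5 y ⟨e, he, hy, hyq.symm, t2⟩ fun p hp hp' => ?_
          rw [hyp p hp (by omega), if_neg (by omega)]
        · intro p hp hp'
          split_ifs with hpq
          · obtain rfl : p = q := by omega
            exact t3
          · exact f6 p hp (by omega)
      · simp
    · rintro S₁ ⟨f1, f2, f3, f4, f5, f6⟩
      have hF₁ : F = forbidden I.r (pool (base I) (stride I) S₁.mem) n :=
        hF.trans (forbidden_pool_congr hn fun a ha => f4 a (Or.inl ha)).symm
      refine ⟨fun j hj => f1 j (by omega), fun a ha => f4 a (by omega), ?_, ?_⟩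
      -- In layer 0 the only nonzero cell is the source, so the empty path starts the word.
      · rw [Nat.sub_self] at f3 f5
        refine f5 _ ?_ fun p _ _ => rfl
        rw [zero_mul, add_zero, f4 _ (by omega)] at f3
        exact (hT.zero _ f2).1 f3
      · intro _ p hp
        rw [← hF₁]
        exact f6 p hp (by omega)
  · intro h
    simp [h14, hS.r, hS.V, hS.t] at h
    have hno : ¬ ∃ y, I.Lang y ∧ ∀ p < I.r, (p, y p) ∉ F :=
      fun ⟨y, hy, hyF⟩ => hT.ne_zero_of_reach le_rfl hy hyF h
    -- The fallback cannot occur at the root: nothing is forbidden there and the language is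
    -- nonempty.
    have hn0 : 0 < n := by
      rw [Nat.pos_iff_ne_zero]
      rintro rfl
      obtain ⟨y, hy⟩ := I.exists_lang
      exact hno ⟨y, hy, by simp [hF, forbidden_zero]⟩
    -- The root string lies below the block of `n`, so copying does not overwrite its source.
    have hsn : stride I ≤ n * stride I := Nat.le_mul_of_pos_left _ hn0
    have hsr : I.r ≤ stride I := Nat.le_add_right _ _
    refine (ok_for (Tb := 8) (by norm_num) (fun k S' => (∀ j < 15, S'.reg j = S.reg j) ∧
      (∀ a, a < base I + n * stride I ∨ c ≤ a → S'.mem a = S.mem a) ∧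
      (∀ p < k, S'.mem (base I + n * stride I + p) = S.mem (base I + p)))
      I.r (by simp [hS.r]) (by omega) (by omega) ?_ ?_ ?_).time (by omega)
    · simp
    · rintro k S₁ hk h16 h2 ⟨f1, f2, f3⟩
      have hS₁ : Ctx I S₁ := hS.frame (fun j hj _ => f1 j (by omega)) fun a ha => f2 a (by omega)
      have h13' := (f1 13 (by norm_num)).trans h13
      refine (ok_write ?_ ?_ ?_).time (by simp)
      · simp [h13', h16]
        omega
      · simp [hS₁.b, h16]
        omega
      · simp [h13', h16, hS₁.b, h2, NState.wr_mem]
        refine ⟨f1, ?_, ?_⟩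
        · intro a ha
          rw [if_neg (by omega), f2 a ha]
        · intro p hp
          split_ifs with h
          · subst h
            exact f2 _ (by omega)
          · exact f3 p (by omega)
    · rintro S₁ ⟨f1, f2, f3⟩
      have hF₁ : F = forbidden I.r (pool (base I) (stride I) S₁.mem) n :=
        hF.trans (forbidden_pool_congr hn fun a ha => f2 a (Or.inl ha)).symm
      refine ⟨fun j hj => f1 j (by omega), fun a ha => f2 a (by omega), ?_, ?_⟩
      · refine Reach.congr (hP 0 hn0).1 fun p hp => ?_
        simp only [pool]
        rw [f3 p hp, zero_mul, add_zero]
      · rw [← hF₁]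
        exact fun h => absurd h hno

/-- Compute the string for the node in register 12. -/
def nodeProg : Program := searchProg ;; extractProg

/-- Writes stay inside the block of `n`: earlier strings remain good, and the later blocks remain
zero, as the next table requires. -/
lemma ok_nodeProg {w n : ℕ} {I : DiverseInstance} {S : NState}
    (hS : Ctx I S) (h12 : S.reg 12 = n) (hn : I.r = 0 → n = 0)
    (hw : base I + (n + 1) * stride I < 2 ^ w)
    (h0 : ∀ a, base I + n * stride I ≤ a → S.mem a = 0)
    (hP : ∀ m < n, GoodNode I.r I.Lang (pool (base I) (stride I) S.mem) m) :
    Ok w nodeProg S ((I.r + 1) * (I.edgeList.length + 1) * (n + 1) * 1000)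
      fun S' => (∀ j < 13, S'.reg j = S.reg j) ∧ (∀ a < base I, S'.mem a = S.mem a) ∧
        (∀ a, base I + (n + 1) * stride I ≤ a → S'.mem a = 0) ∧
        ∀ m < n + 1, GoodNode I.r I.Lang (pool (base I) (stride I) S'.mem) m := by
  refine (Ok.seq (ok_searchProg hS h12 hn hw rfl h0) (T₂ := 100 + (I.r + 1) * 100) ?_).time ?_
  · rintro S₁ ⟨f1, f2, f3, f4, f5⟩
    have hmn : n * stride I ≤ (n + 1) * stride I := Nat.mul_le_mul_right _ (Nat.le_succ n)
    have hta : tableAddr I n = base I + n * stride I + I.r := rfl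
    have hS₁ : Ctx I S₁ := hS.frame (fun j hj _ => f1 j (by omega)) fun a ha => f5 a (by omega)
    have hP₁ : ∀ m < n, GoodNode I.r I.Lang (pool (base I) (stride I) S₁.mem) m := by
      intro m hm
      refine goodNode_congr (fun h => ?_) (fun m' hm' p hp => ?_) (hP m hm)
      · have := hn h
        omega
      · exact (f5 _ (Or.inl ((pool_lt (hm'.trans_lt hm) hp).trans_le (by omega)))).symm
    refine (ok_extractProg hS₁ hn hw f2 f3 ?_ f4 hP₁).mono le_rfl ?_
    · exact (forbidden_pool_congr hn fun a ha => f5 a (by omega)).symm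
    · rintro S₂ ⟨g1, g2, g3⟩
      refine ⟨fun j hj => (g1 j hj).trans (f1 j hj), ?_, ?_, ?_⟩
      · intro a ha
        rw [g2 a (by omega), f5 a (by omega)]
      · intro a ha
        rw [g2 a (Or.inr ha), f5 a (Or.inr ha), h0 a (by omega)]
      · intro m hm
        rcases Nat.lt_succ_iff_lt_or_eq.1 hm with hm | rfl
        · refine goodNode_congr (fun h => ?_) (fun m' hm' p hp => ?_) (hP₁ m hm)
          · have := hn h
            omega
          · exact (g2 _ (Or.inl (pool_lt (hm'.trans_lt hm) hp))).symm
        · exact g3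
  · have h1 : 1 ≤ (I.r + 1) * (I.edgeList.length + 1) * (n + 1) :=
      Nat.one_le_iff_ne_zero.2 (by positivity)
    have h2 : I.r + 1 ≤ (I.r + 1) * (I.edgeList.length + 1) * (n + 1) := by
      rw [mul_assoc]
      exact Nat.le_mul_of_pos_right _ (by positivity)
    have h3 : (I.r + 1) * (I.edgeList.length + 1) ≤
        (I.r + 1) * (I.edgeList.length + 1) * (n + 1) := Nat.le_mul_of_pos_right _ (by positivity)
    nlinarith

/-! ### Checking a tuple of strings -/

/-- Compute the distance of the strings at the addresses in the registers 17 and 20. -/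
def distProg : Program :=
  22 ≔ const 0 ;;
  forLoop 21 2 (branch (read (reg 17 +ₜ reg 21) =ₜ read (reg 20 +ₜ reg 21)) skip
    (22 ≔ reg 22 +ₜ const 1))

lemma prefixDist_succ (r : ℕ) (y z : ℕ → ℕ) :
    prefixDist (r + 1) y z = prefixDist r y z + if y r = z r then 0 else 1 :=
  Finset.sum_range_succ _ _

lemma prefixDist_le (r : ℕ) (y z : ℕ → ℕ) : prefixDist r y z ≤ r := by
  refine (Finset.sum_le_card_nsmul _ _ 1 fun p _ => ?_).trans (by simp)
  split_ifs <;> omega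

lemma ok_distProg {w r a b : ℕ} {S : NState} (hw : 1 < 2 ^ w) (hr : S.reg 2 = r)
    (h17 : S.reg 17 = a) (h20 : S.reg 20 = b) (ha : a + r < 2 ^ w) (hb : b + r < 2 ^ w) :
    Ok w distProg S ((r + 1) * 30 + 2) fun S' => S'.mem = S.mem ∧ (∀ j < 21, S'.reg j = S.reg j) ∧
      S'.reg 22 = prefixDist r (fun p => S.mem (a + p)) fun p => S.mem (b + p) := by
  have hw0 : w ≠ 0 := by
    rintro rfl
    omega
  refine (ok_assign_seq (T := (r + 1) * (20 + 10)) (by simp) (ok_for (by norm_num)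
    (fun k S' => S'.mem = S.mem ∧ (∀ j < 21, S'.reg j = S.reg j) ∧
      S'.reg 22 = prefixDist k (fun p => S.mem (a + p)) fun p => S.mem (b + p)) r _
    (by simp [hr]) (by omega) (by omega) ?_ ?_ fun _ h => h)).time
      (by simp only [Term.cost]; omega)
  · simp [prefixDist]
  · rintro k S₁ hk h21 h2 ⟨f1, f2, f3⟩
    have h17' := (f2 17 (by norm_num)).trans h17
    have h20' := (f2 20 (by norm_num)).trans h20
    have hd := prefixDist_le k (fun p => S.mem (a + p)) fun p => S.mem (b + p)
    refine (ok_branch (T₁ := 1) (T₂ := 4) ?_ ?_ ?_).time (by simp)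
    · simp [h21, h17', h20']
      omega
    · intro h
      simp [h21, h17', h20', f1] at h
      refine ok_skip ?_
      simp [h21, h2, f1, f3, prefixDist_succ, h]
      exact f2
    · intro h
      simp [h21, h17', h20', f1] at h
      refine ok_assign ?_ ?_
      · simp [f3]
        omega
      · simp [h21, h2, f1, f3, prefixDist_succ, h]
        exact f2

/-- Compare the string at the address in register 17 with the one whose number is the last digit of
the number in register 19. -/
def pairProg : Program :=
  20 ≔ reg 8 +ₜ reg 19 %ₜ reg 9 *ₜ reg 11 ;;
  distProg ;;
  branch (reg 22) skip (13 ≔ const 0) ;;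
  14 ≔ reg 14 +ₜ reg 22 ;;
  19 ≔ reg 19 /ₜ reg 9

lemma treeSize_pos (I : DiverseInstance) : 0 < treeSize I := Nat.pow_pos (Nat.succ_pos _)

lemma digit_addr_le (I : DiverseInstance) (c : ℕ) :
    c % treeSize I * stride I + stride I ≤ treeSize I * stride I := by
  rw [← Nat.succ_mul]
  exact Nat.mul_le_mul_right _ (Nat.mod_lt _ (treeSize_pos I))

/-- Register 13 is a flag for distinctness that can only be cleared, register 14 accumulates the
distances, and dividing register 19 by the tree size exposes the next digit. -/
lemma ok_pairProg {w a x : ℕ} {I : DiverseInstance} {S : NState} (hS : Ctx I S)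
    (hw : base I + treeSize I * stride I < 2 ^ w) (h17 : S.reg 17 = a) (ha : a + I.r < 2 ^ w)
    (h19 : S.reg 19 = x) (h14 : S.reg 14 + I.r < 2 ^ w) :
    Ok w pairProg S ((I.r + 1) * 30 + 50) fun S' => S'.mem = S.mem ∧
      (∀ j < 13, S'.reg j = S.reg j) ∧ S'.reg 15 = S.reg 15 ∧ S'.reg 16 = S.reg 16 ∧
      S'.reg 17 = S.reg 17 ∧ S'.reg 18 = S.reg 18 ∧ S'.reg 19 = x / treeSize I ∧
      (S'.reg 13 ≠ 0 ↔ S.reg 13 ≠ 0 ∧ prefixDist I.r (fun p => S.mem (a + p))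
        (pool (base I) (stride I) S.mem (x % treeSize I)) ≠ 0) ∧
      S'.reg 14 = S.reg 14 + prefixDist I.r (fun p => S.mem (a + p))
        (pool (base I) (stride I) S.mem (x % treeSize I)) := by
  have hb8 : base I = 8 + 3 * I.edgeList.length := rfl
  have hw0 : w ≠ 0 := by
    rintro rfl
    omega
  have hx := digit_addr_le I x
  have hsr : I.r ≤ stride I := Nat.le_add_right _ _
  set d := prefixDist I.r (fun p => S.mem (a + p))
    (pool (base I) (stride I) S.mem (x % treeSize I)) with hd
  have hdr : d ≤ I.r := prefixDist_le _ _ _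
  refine (ok_assign_seq ?_ (Ok.seq (T₂ := 20) (ok_distProg (r := I.r) (a := a)
    (b := base I + x % treeSize I * stride I) (by omega) (by simpa using hS.r) (by simpa using h17)
    (by simp [hS.b, hS.N, hS.D, h19]) ha (by omega)) ?_)).time (by simp only [Term.cost]; omega)
  · simp [hS.b, hS.N, hS.D, h19]
    omega
  rintro S₁ ⟨f1, f2, f3⟩
  simp only [NState.set_mem] at f1 f3
  change S₁.reg 22 = d at f3
  have k9 : S₁.reg 9 = treeSize I := by simp [f2 9, hS.N]
  have k14 : S₁.reg 14 = S.reg 14 := by simp [f2 14]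
  have k19 : S₁.reg 19 = x := by simp [f2 19, h19]
  have hf : ∀ j < 20, S₁.reg j = S.reg j := by
    intro j hj
    rw [f2 j (by omega), NState.set_reg_of_ne _ _ (by omega)]
  refine (Ok.seq (T₂ := 8) (R := fun S' => S'.mem = S.mem ∧
    (∀ j < 20, j ≠ 13 → S'.reg j = S.reg j) ∧ S'.reg 22 = d ∧
    (S'.reg 13 ≠ 0 ↔ S.reg 13 ≠ 0 ∧ d ≠ 0)) (ok_branch (T₁ := 1) (T₂ := 2) ?_ ?_ ?_) ?_).time
    (by simp)
  · simp
  · intro h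
    simp only [Term.val, f3] at h
    refine ok_skip ⟨f1, fun j hj _ => hf j hj, f3, ?_⟩
    rw [hf 13 (by norm_num)]
    simp [h]
  · intro h
    simp only [Term.val, f3] at h
    refine ok_assign (by simp) ?_
    simp only [NState.set_mem, Term.val]
    refine ⟨f1, fun j hj hj' => ?_, by simp [f3], by simp [h]⟩
    rw [NState.set_reg_of_ne _ _ hj', hf j hj]
  · rintro S₂ ⟨g1, g2, g3, g4⟩
    have m9 : S₂.reg 9 = treeSize I := by rw [g2 9 (by norm_num) (by norm_num), hS.N]
    have m14 : S₂.reg 14 = S.reg 14 := g2 14 (by norm_num) (by norm_num)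
    have m19 : S₂.reg 19 = x := by rw [g2 19 (by norm_num) (by norm_num), h19]
    refine (ok_assign_seq ?_ (ok_assign ?_ ?_)).time (by simp)
    · simp [m14, g3]
      omega
    · simp
    · simp [m14, g3, m19, m9, g1]
      exact ⟨fun j hj => g2 j (by omega) (by omega), g2 15 (by norm_num) (by norm_num),
        g2 16 (by norm_num) (by norm_num), g2 17 (by norm_num) (by norm_num),
        g2 18 (by norm_num) (by norm_num), by simpa using g4⟩

/-- Compare the string whose number is the last digit of the number in register 16 with those
before it in the tuple. -/
def rowProg : Program :=
  17 ≔ reg 8 +ₜ reg 16 %ₜ reg 9 *ₜ reg 11 ;;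
  19 ≔ reg 12 ;;
  forLoop 18 15 pairProg ;;
  16 ≔ reg 16 /ₜ reg 9

lemma div_pow_succ (c N j : ℕ) : c / N ^ (j + 1) = c / N ^ j / N := by
  rw [pow_succ, Nat.div_div_eq_div_mul]

/-- Register 16 keeps its place at digit `i`, while register 19 restarts at `c` and runs through the
digits below `i`. -/
lemma ok_rowProg {w c i : ℕ} {I : DiverseInstance} {S : NState} (hS : Ctx I S)
    (hw : base I + treeSize I * stride I < 2 ^ w) (h12 : S.reg 12 = c) (h15 : S.reg 15 = i)
    (h16 : S.reg 16 = c / treeSize I ^ i) (hi : i < 2 ^ w) (h14 : S.reg 14 + i * I.r < 2 ^ w) :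
    Ok w rowProg S ((i + 1) * ((I.r + 1) * 30 + 60) + 20) fun S' => S'.mem = S.mem ∧
      (∀ j < 13, S'.reg j = S.reg j) ∧ S'.reg 15 = i ∧ S'.reg 16 = c / treeSize I ^ (i + 1) ∧
      (S'.reg 13 ≠ 0 ↔ S.reg 13 ≠ 0 ∧ ∀ j < i, prefixDist I.r
        (pool (base I) (stride I) S.mem (digit (treeSize I) c i))
        (pool (base I) (stride I) S.mem (digit (treeSize I) c j)) ≠ 0) ∧
      S'.reg 14 = S.reg 14 + ∑ j ∈ Finset.range i, prefixDist I.r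
        (pool (base I) (stride I) S.mem (digit (treeSize I) c i))
        (pool (base I) (stride I) S.mem (digit (treeSize I) c j)) := by
  have hb8 : base I = 8 + 3 * I.edgeList.length := rfl
  have hw0 : w ≠ 0 := by
    rintro rfl
    omega
  have hx := digit_addr_le I (c / treeSize I ^ i)
  have hsr : I.r ≤ stride I := Nat.le_add_right _ _
  set d : ℕ → ℕ := fun j => prefixDist I.r
    (pool (base I) (stride I) S.mem (digit (treeSize I) c i))
    (pool (base I) (stride I) S.mem (digit (treeSize I) c j)) with hd
  have hdr : ∀ j, ∑ k ∈ Finset.range j, d k ≤ j * I.r := fun j =>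
    (Finset.sum_le_card_nsmul _ _ I.r fun k _ => prefixDist_le _ _ _).trans (by simp)
  refine (ok_assign_seq ?_ (ok_assign_seq ?_ (Ok.seq
    (T₁ := (i + 1) * (((I.r + 1) * 30 + 50) + 10)) (T₂ := 4)
    (R := fun S' => S'.mem = S.mem ∧
      (∀ j < 13, S'.reg j = S.reg j) ∧ S'.reg 15 = i ∧ S'.reg 16 = c / treeSize I ^ i ∧
      (S'.reg 13 ≠ 0 ↔ S.reg 13 ≠ 0 ∧ ∀ j < i, d j ≠ 0) ∧
      S'.reg 14 = S.reg 14 + ∑ j ∈ Finset.range i, d j)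
    (ok_for (by norm_num) (fun k S' => S'.mem = S.mem ∧
      (∀ j < 13, S'.reg j = S.reg j) ∧ S'.reg 15 = i ∧ S'.reg 16 = c / treeSize I ^ i ∧
      S'.reg 17 = base I + digit (treeSize I) c i * stride I ∧ S'.reg 19 = c / treeSize I ^ k ∧
      (S'.reg 13 ≠ 0 ↔ S.reg 13 ≠ 0 ∧ ∀ j < k, d j ≠ 0) ∧
      S'.reg 14 = S.reg 14 + ∑ j ∈ Finset.range k, d j) i _ ?_ (by omega) hi ?_ ?_ ?_) ?_))).time
      (by simp only [Term.cost]; linarith)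
  · simp [hS.b, hS.N, hS.D, h16]
    omega
  · simp
  · simp [h15]
  · simp [h15, h16, h12, hS.b, hS.N, hS.D, digit]
  · rintro k S₁ hk h18 - ⟨f1, f2, f3, f4, f5, f6, f7, f8⟩
    have hS₁ : Ctx I S₁ := hS.frame (fun j hj _ => f2 j (by omega)) fun a _ => by rw [f1]
    have hki : (k + 1) * I.r ≤ i * I.r := Nat.mul_le_mul_right _ hk
    rw [Nat.succ_mul] at hki
    have hdk := hdr k
    refine (ok_pairProg hS₁ hw f5 ?_ f6 (by omega)).mono le_rfl ?_
    · unfold digit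
      omega
    · rintro S₂ ⟨g1, g2, g3, g4, g5, g6, g7, g8, g9⟩
      rw [f1] at g1 g8 g9
      change _ ↔ _ ∧ d k ≠ 0 at g8
      change _ = _ + d k at g9
      refine ⟨g6.trans h18, g3.trans f3, ?_⟩
      simp only [NState.set_mem, NState.set_reg]
      refine ⟨g1, fun j hj => ?_, ?_, ?_, ?_, ?_, ?_, ?_⟩
      · rw [if_neg (by omega), g2 j hj, f2 j hj]
      · simp [g3, f3]
      · simp [g4, f4]
      · simp [g5, f5]
      · simp [g7, div_pow_succ]
      · rw [if_neg (by norm_num), g8, f7, Nat.forall_lt_succ_right, and_assoc]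
      · rw [if_neg (by norm_num), g9, f8, Finset.sum_range_succ, add_assoc]
  · rintro S₁ ⟨f1, f2, f3, f4, f5, f6, f7, f8⟩
    exact ⟨f1, f2, f3, f4, f7, f8⟩
  · rintro S₁ ⟨f1, f2, f3, f4, f7, f8⟩
    refine ok_assign (by simp) ?_
    have h9 := (f2 9 (by norm_num)).trans hS.N
    simp [f1, f3, f4, f8, h9, div_pow_succ]
    exact ⟨f2, by simpa using f7⟩

/-- Set register 0 to one if the tuple with the number in register 12 is a solution. -/
def tupleProg : Program :=
  13 ≔ const 1 ;;
  14 ≔ const 0 ;;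
  16 ≔ reg 12 ;;
  forLoop 15 1 rowProg ;;
  branch (reg 13) (branch (reg 14 <ₜ reg 3) skip (0 ≔ const 1)) skip

lemma ok_tupleProg {w c : ℕ} {I : DiverseInstance} {S : NState} (hS : Ctx I S)
    (hw : base I + treeSize I * stride I < 2 ^ w) (h12 : S.reg 12 = c) (hK : I.K < 2 ^ w)
    (hKr : I.K * (I.K * I.r) < 2 ^ w) :
    Ok w tupleProg S ((I.K + 1) * ((I.K + 1) * ((I.r + 1) * 30 + 60) + 30) + 30) fun S' =>
      S'.mem = S.mem ∧ (∀ j < 13, 0 < j → S'.reg j = S.reg j) ∧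
      (GoodTuple I.r I.K (treeSize I) I.Δ (pool (base I) (stride I) S.mem) c → S'.reg 0 = 1) ∧
      (¬ GoodTuple I.r I.K (treeSize I) I.Δ (pool (base I) (stride I) S.mem) c →
        S'.reg 0 = S.reg 0) := by
  have hb8 : base I = 8 + 3 * I.edgeList.length := rfl
  have hw0 : w ≠ 0 := by
    rintro rfl
    omega
  set d : ℕ → ℕ → ℕ := fun i j => prefixDist I.r
    (pool (base I) (stride I) S.mem (digit (treeSize I) c i))
    (pool (base I) (stride I) S.mem (digit (treeSize I) c j)) with hd
  have hdr : ∀ i, ∑ j ∈ Finset.range i, d i j ≤ i * I.r := fun j =>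
    (Finset.sum_le_card_nsmul _ _ I.r fun k _ => prefixDist_le _ _ _).trans (by simp)
  -- Each of at most K rows adds at most K distances of size at most r, which keeps the running sum
  -- within a word.
  have hsum : ∀ i ≤ I.K, ∑ k ∈ Finset.range i, ∑ j ∈ Finset.range k, d k j ≤ i * (I.K * I.r) := by
    intro i hi
    refine (Finset.sum_le_card_nsmul _ _ (I.K * I.r) fun k hk => (hdr k).trans ?_).trans (by simp)
    exact Nat.mul_le_mul_right _ ((Finset.mem_range.1 hk).le.trans hi)
  refine (ok_assign_seq ?_ (ok_assign_seq ?_ (ok_assign_seq ?_ (Ok.seq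
    (T₁ := (I.K + 1) * (((I.K + 1) * ((I.r + 1) * 30 + 60) + 20) + 10)) (T₂ := 11)
    (R := fun S' => S'.mem = S.mem ∧ (∀ j < 13, S'.reg j = S.reg j) ∧
      (S'.reg 13 ≠ 0 ↔ ∀ i < I.K, ∀ j < i, d i j ≠ 0) ∧
      S'.reg 14 = ∑ i ∈ Finset.range I.K, ∑ j ∈ Finset.range i, d i j)
    (ok_for (by norm_num) (fun i S' => S'.mem = S.mem ∧
      (∀ j < 13, S'.reg j = S.reg j) ∧ S'.reg 16 = c / treeSize I ^ i ∧
      (S'.reg 13 ≠ 0 ↔ ∀ k < i, ∀ j < k, d k j ≠ 0) ∧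
      S'.reg 14 = ∑ k ∈ Finset.range i, ∑ j ∈ Finset.range k, d k j)
      I.K _ ?_ (by omega) hK ?_ ?_ ?_) ?_)))).time
      (by simp only [Term.cost]; linarith)
  · simp [hw0]
  · simp
  · simp
  · simp [hS.K]
  · simp [h12]
  · rintro i S₁ hi h15 h1 ⟨f1, f2, f3, f4, f5⟩
    have hS₁ : Ctx I S₁ := hS.frame (fun j hj _ => f2 j (by omega)) fun a _ => by rw [f1]
    have hiK : (i + 1) * (I.K * I.r) ≤ I.K * (I.K * I.r) := Nat.mul_le_mul_right _ hi
    have hiK' : i * I.r ≤ I.K * I.r := Nat.mul_le_mul_right _ hi.le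
    rw [Nat.succ_mul] at hiK
    have hsi := hsum i hi.le
    refine (ok_rowProg hS₁ hw ((f2 12 (by norm_num)).trans h12) h15 f3 (by omega)
      (by rw [f5]; omega)).mono ?_ ?_
    · gcongr
    · rintro S₂ ⟨g1, g2, g3, g4, g5, g6⟩
      rw [f1] at g1 g5 g6
      change _ ↔ _ ∧ ∀ j < i, d i j ≠ 0 at g5
      change _ = _ + ∑ j ∈ Finset.range i, d i j at g6
      refine ⟨g3, (g2 1 (by norm_num)).trans h1, ?_⟩
      simp only [NState.set_mem, NState.set_reg]
      refine ⟨g1, fun j hj => ?_, ?_, ?_, ?_⟩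
      · rw [if_neg (by omega), g2 j hj, f2 j hj]
      · rw [if_neg (by norm_num), g4]
      · rw [if_neg (by norm_num), g5, f4, Nat.forall_lt_succ_right]
      · rw [if_neg (by norm_num), g6, f5, Finset.sum_range_succ]
  · rintro S₁ ⟨f1, f2, f3, f4, f5⟩
    exact ⟨f1, f2, f4, f5⟩
  · rintro S₁ ⟨f1, f2, f4, f5⟩
    have h3 := (f2 3 (by norm_num)).trans hS.Δ
    have hgood : GoodTuple I.r I.K (treeSize I) I.Δ (pool (base I) (stride I) S.mem) c ↔
        S₁.reg 13 ≠ 0 ∧ I.Δ ≤ S₁.reg 14 := by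
      rw [f4, f5]
      rfl
    rw [hgood]
    refine (ok_branch (T₁ := 7) (T₂ := 1) ?_ ?_ ?_).time (by simp)
    · simp
    · intro h
      simp only [Term.val] at h
      refine (ok_branch (T₁ := 1) (T₂ := 2) ?_ ?_ ?_).time (by simp)
      · simp
      · intro h'
        simp [h3] at h'
        exact ok_skip ⟨f1, fun j hj _ => f2 j hj, fun hh => by omega,
          fun _ => f2 0 (by norm_num)⟩
      · intro h'
        simp [h3] at h'
        refine ok_assign (by simp [hw0]) ⟨f1, fun j hj hj' => ?_, ?_, ?_⟩
        · rw [NState.set_reg_of_ne _ _ (by omega), f2 j hj]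
        · simp
        · exact fun hh => absurd ⟨h, h'⟩ hh
    · intro h
      simp only [Term.val] at h
      exact ok_skip ⟨f1, fun j hj _ => f2 j hj, fun hh => absurd h hh.1,
        fun _ => f2 0 (by norm_num)⟩

/-! ### The whole program -/

/-- Load the parameters of the instance into registers. -/
def loadProg : Program :=
  1 ≔ read (const 0) ;;
  2 ≔ read (const 1) ;;
  3 ≔ read (const 2) ;;
  4 ≔ read (const 3) ;;
  5 ≔ read (const 5) ;;
  6 ≔ read (const 6) ;;
  7 ≔ read (const 7) ;;
  8 ≔ const 8 +ₜ const 3 *ₜ reg 7 ;;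
  11 ≔ reg 2 +ₜ (reg 2 +ₜ const 1) *ₜ reg 4 ;;
  9 ≔ const 1 ;;
  12 ≔ reg 2 *ₜ reg 1 ;;
  forLoop 13 12 (9 ≔ reg 9 *ₜ (reg 2 +ₜ const 1)) ;;
  10 ≔ const 1 ;;
  forLoop 13 1 (10 ≔ reg 10 *ₜ reg 9)

lemma word_header (I : DiverseInstance) : I.word 0 = I.K ∧ I.word 1 = I.r ∧ I.word 2 = I.Δ ∧
    I.word 3 = I.numV ∧ I.word 5 = I.G.s ∧ I.word 6 = I.G.t ∧ I.word 7 = I.edgeList.length :=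
  ⟨rfl, rfl, rfl, rfl, rfl, rfl, rfl⟩

lemma ok_loadProg {w : ℕ} {I : DiverseInstance} {S : NState} (hreg : ∀ j, S.reg j = 0)
    (hmem : ∀ a, S.mem a = I.word a)
    (hw : base I + treeSize I * stride I < 2 ^ w) (hN : treeSize I < 2 ^ w)
    (hM : treeSize I ^ I.K < 2 ^ w) (hK : I.K < 2 ^ w) (hr : I.r + 1 < 2 ^ w)
    (hrK : I.r * I.K < 2 ^ w) :
    Ok w loadProg S ((I.r * I.K + 1) * 17 + (I.K + 1) * 15 + 100) fun S' =>
      Ctx I S' ∧ S'.reg 0 = 0 ∧ S'.mem = S.mem := by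
  have hb8 : base I = 8 + 3 * I.edgeList.length := rfl
  have hw1 : 8 < 2 ^ w := by omega
  have hw0 : w ≠ 0 := by
    rintro rfl
    omega
  obtain ⟨w0, w1, w2, w3, w5, w6, w7⟩ := word_header I
  have hNpos := treeSize_pos I
  have hsN : stride I ≤ treeSize I * stride I := Nat.le_mul_of_pos_left _ hNpos
  have hs : stride I = I.r + (I.r + 1) * I.numV := rfl
  refine (ok_assign_seq (by simp) (ok_assign_seq (by simp; omega) (ok_assign_seq (by simp; omega)
    (ok_assign_seq (by simp; omega) (ok_assign_seq (by simp; omega) (ok_assign_seq (by simp; omega)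
    (ok_assign_seq (by simp; omega) (ok_assign_seq ?_ (ok_assign_seq ?_
    (ok_assign_seq (by simp [hw0]) (ok_assign_seq ?_ (Ok.seq (T₁ := (I.r * I.K + 1) * (6 + 10))
      (T₂ := 2 + (I.K + 1) * (4 + 10))
      (R := fun S' => (∀ j < 9, S'.reg j = ([0, I.K, I.r, I.Δ, I.numV, I.G.s, I.G.t,
        I.edgeList.length, base I] : List ℕ).getD j 0) ∧ S'.reg 11 = stride I ∧
        S'.mem = S.mem ∧ S'.reg 9 = treeSize I)
      (ok_for (by norm_num) (fun k S' =>
        (∀ j < 9, S'.reg j = ([0, I.K, I.r, I.Δ, I.numV, I.G.s, I.G.t,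
        I.edgeList.length, base I] : List ℕ).getD j 0) ∧ S'.reg 11 = stride I ∧
        S'.mem = S.mem ∧ S'.reg 9 = (I.r + 1) ^ k) (I.r * I.K) _
        ?_ (by omega) hrK ?_ ?_ fun _ h => h) ?_)))))))))))).time ?_
  · simp [hmem, w7]
    omega
  · simp [hmem, w1, w3]
    omega
  · simp [hmem, w0, w1, hrK]
  · simp [hmem, w0, w1]
  · simp [hmem, w0, w1, w2, w3, w5, w6, w7, hs, base, hreg]
    intro j hj
    interval_cases j <;> simp
  · rintro k S₁ hk h13 h12 ⟨f1, f2, f3, f4⟩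
    have h2 : S₁.reg 2 = I.r := f1 2 (by norm_num)
    -- Partial powers do not exceed the final one, so no product overflows.
    have hp : (I.r + 1) ^ (k + 1) ≤ treeSize I := Nat.pow_le_pow_right (Nat.succ_pos _) hk
    refine (ok_assign ?_ ?_).time (by simp)
    · simp [h2, f4, hw0, ← pow_succ]
      omega
    · simp [h2, f4, ← pow_succ, h12, h13, f2, f3]
      exact f1
  · rintro S₁ ⟨f1, f2, f3, f4⟩
    refine ok_assign_seq (by simp [hw0]) (ok_for (by norm_num) (fun k S' =>
        (∀ j < 9, S'.reg j = ([0, I.K, I.r, I.Δ, I.numV, I.G.s, I.G.t,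
        I.edgeList.length, base I] : List ℕ).getD j 0) ∧ S'.reg 11 = stride I ∧
        S'.mem = S.mem ∧ S'.reg 9 = treeSize I ∧ S'.reg 10 = treeSize I ^ k) I.K _
        ?_ (by omega) hK ?_ ?_ ?_)
    · simpa using f1 1 (by norm_num)
    · simp [f2, f3, f4]
      exact f1
    · rintro k S₂ hk h13 h1 ⟨g1, g2, g3, g4, g5⟩
      have hp : treeSize I ^ (k + 1) ≤ treeSize I ^ I.K := Nat.pow_le_pow_right hNpos hk
      refine (ok_assign ?_ ?_).time (by simp)
      · simp [g4, g5, ← pow_succ]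
        omega
      · simp [h13, h1, g2, g3, g4, g5, ← pow_succ]
        exact g1
    · rintro S₂ ⟨g1, g2, g3, g4, g5⟩
      exact ⟨⟨g1 1 (by norm_num), g1 2 (by norm_num), g1 3 (by norm_num), g1 4 (by norm_num),
        g1 5 (by norm_num), g1 6 (by norm_num), g1 7 (by norm_num), g1 8 (by norm_num), g4, g5, g2,
        fun a _ => by rw [g3, hmem]⟩, g1 0 (by norm_num), g3⟩
  · simp only [Term.cost]
    omega

/-- A program for Max-Sum Diverse String Set. -/
def diverseProg : Program :=
  loadProg ;;
  forLoop 12 9 nodeProg ;;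
  forLoop 12 10 tupleProg

lemma word_eq_zero (I : DiverseInstance) {a : ℕ} (ha : base I ≤ a) : I.word a = 0 :=
  List.getD_eq_default _ _ (by rw [I.encode_length]; exact ha)

/-- After the first loop all node strings in memory are good, so `DiverseInstance.isYes_iff` applies
to them; the second loop tries every tuple and leaves register 0 set once a good one is found. -/
lemma ok_diverseProg {w : ℕ} {I : DiverseInstance} {S : NState} (hreg : ∀ j, S.reg j = 0)
    (hmem : ∀ a, S.mem a = I.word a)
    (hw : base I + treeSize I * stride I < 2 ^ w) (hN : treeSize I < 2 ^ w)
    (hM : treeSize I ^ I.K < 2 ^ w) (hK : I.K < 2 ^ w) (hr : I.r + 1 < 2 ^ w)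
    (hrK : I.r * I.K < 2 ^ w) (hKr : I.K * (I.K * I.r) < 2 ^ w) :
    Ok w diverseProg S ((I.r * I.K + 1) * 17 + (I.K + 1) * 15 + 100 + ((treeSize I + 1) *
      ((I.r + 1) * (I.edgeList.length + 1) * treeSize I * 1000 + 10) +
      (treeSize I ^ I.K + 1) *
        ((I.K + 1) * ((I.K + 1) * ((I.r + 1) * 30 + 60) + 30) + 30 + 10))) fun S' =>
      (I.IsYes → S'.reg 0 = 1) ∧ (¬ I.IsYes → S'.reg 0 = 0) := by
  have hb8 : base I = 8 + 3 * I.edgeList.length := rfl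
  have hw1 : 1 < 2 ^ w := by omega
  refine Ok.seq (ok_loadProg hreg hmem hw hN hM hK hr hrK) ?_
  rintro S₁ ⟨hS₁, h0, hm⟩
  refine Ok.seq (R := fun S' => (∀ j < 12, S'.reg j = S₁.reg j) ∧
    (∀ a < base I, S'.mem a = S₁.mem a) ∧
    ∀ m < treeSize I, GoodNode I.r I.Lang (pool (base I) (stride I) S'.mem) m) (ok_for (by norm_num)
    (fun n S' => (∀ j < 12, S'.reg j = S₁.reg j) ∧ (∀ a < base I, S'.mem a = S₁.mem a) ∧
      (∀ a, base I + n * stride I ≤ a → S'.mem a = 0) ∧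
      ∀ m < n, GoodNode I.r I.Lang (pool (base I) (stride I) S'.mem) m) (treeSize I) _
    hS₁.N hw1 hN ?_ ?_ fun S' h => ⟨h.1, h.2.1, h.2.2.2⟩) ?_
  · refine ⟨by simp, by simp, ?_, by simp⟩
    intro a ha
    rw [zero_mul, add_zero] at ha
    rw [NState.set_mem, hm, hmem, word_eq_zero I ha]
  · rintro n S₂ hn h12 h9 ⟨f1, f2, f3, f4⟩
    have hn1 : (n + 1) * stride I ≤ treeSize I * stride I := Nat.mul_le_mul_right _ hn
    refine (ok_nodeProg (hS₁.frame (fun j hj _ => f1 j hj) f2) h12 (fun h => ?_) (by omega) f3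
      f4).mono ?_ ?_
    -- For r = 0 the tree size is 1, so the root is the only node.
    · rw [treeSize, h] at hn
      simpa using hn
    · gcongr
      exact hn
    · rintro S₃ ⟨g1, g2, g3, g4⟩
      refine ⟨(g1 12 (by norm_num)).trans h12, (g1 9 (by norm_num)).trans h9, ?_⟩
      simp only [NState.set_mem]
      refine ⟨fun j hj => ?_, fun a ha => (g2 a ha).trans (f2 a ha), g3, g4⟩
      rw [NState.set_reg_of_ne _ _ (by omega), g1 j (by omega), f1 j hj]
  · rintro S₂ ⟨f1, f2, f3⟩
    have hS₂ : Ctx I S₂ := hS₁.frame (fun j hj _ => f1 j hj) f2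
    have hyes := I.isYes_iff (N := treeSize I) rfl _ f3
    set Good := GoodTuple I.r I.K (treeSize I) I.Δ (pool (base I) (stride I) S₂.mem) with hGood
    refine ok_for (by norm_num) (fun c S' => S'.mem = S₂.mem ∧
      (∀ j < 12, 0 < j → S'.reg j = S₂.reg j) ∧ ((∃ c' < c, Good c') → S'.reg 0 = 1) ∧
      (¬ (∃ c' < c, Good c') → S'.reg 0 = 0)) (treeSize I ^ I.K) _ hS₂.M hw1 hM ?_ ?_ ?_
    · refine ⟨rfl, fun j hj _ => NState.set_reg_of_ne _ _ (by omega), by simp, fun _ => ?_⟩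
      rw [NState.set_reg_of_ne _ _ (by norm_num), f1 0 (by norm_num), h0]
    · rintro c S₃ hc h12 h10 ⟨g1, g2, g3, g4⟩
      refine (ok_tupleProg (hS₂.frame g2 fun a _ => by rw [g1]) hw h12 hK hKr).mono le_rfl ?_
      rintro S₄ ⟨k1, k2, k3, k4⟩
      rw [g1] at k3 k4 k1
      refine ⟨(k2 12 (by norm_num) (by norm_num)).trans h12,
        (k2 10 (by norm_num) (by norm_num)).trans h10, k1, fun j hj hj' => ?_, ?_, ?_⟩
      · rw [NState.set_reg_of_ne _ _ (by omega), k2 j (by omega) hj', g2 j hj hj']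
      · rw [NState.set_reg_of_ne _ _ (by norm_num)]
        rintro ⟨c', hc', h⟩
        by_cases hG : Good c
        · exact k3 hG
        · rw [k4 hG]
          refine g3 ⟨c', lt_of_le_of_ne (Nat.lt_succ_iff.1 hc') ?_, h⟩
          rintro rfl
          exact hG h
      · rw [NState.set_reg_of_ne _ _ (by norm_num)]
        intro h
        rw [k4 fun hG => h ⟨c, Nat.lt_succ_self c, hG⟩]
        exact g4 fun ⟨c', hc', h'⟩ => h ⟨c', hc'.trans (Nat.lt_succ_self c), h'⟩
    · rintro S₃ ⟨-, -, g3, g4⟩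
      rw [hyes]
      exact ⟨g3, g4⟩

/-! ### Time and word-size bounds -/

/-- The dependence of the running time on the parameters. -/
def timeFactor (κ : ℕ × ℕ) : ℕ :=
  10000 * (((κ.2 + 1) ^ (κ.2 * κ.1) + 1) * ((κ.2 + 1) ^ (κ.2 * κ.1) + 1) *
    (((κ.2 + 1) ^ (κ.2 * κ.1)) ^ κ.1 + 1) * ((κ.1 + 1) * (κ.1 + 1)) * (κ.2 + 1))

lemma computable_timeFactor : Computable timeFactor := by
  have hpow : Primrec₂ fun a b : ℕ => a ^ b := Primrec₂.unpaired'.1 Nat.Primrec.pow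
  have hr : Primrec fun κ : ℕ × ℕ => κ.2 + 1 := Primrec.succ.comp Primrec.snd
  have hK : Primrec fun κ : ℕ × ℕ => κ.1 + 1 := Primrec.succ.comp Primrec.fst
  have hN : Primrec fun κ : ℕ × ℕ => (κ.2 + 1) ^ (κ.2 * κ.1) :=
    hpow.comp hr (Primrec.nat_mul.comp Primrec.snd Primrec.fst)
  have hN1 := Primrec.succ.comp hN
  have hM1 := Primrec.succ.comp (hpow.comp hN Primrec.fst)
  exact (Primrec.nat_mul.comp (Primrec.const 10000) (Primrec.nat_mul.comp (Primrec.nat_mul.comp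
    (Primrec.nat_mul.comp (Primrec.nat_mul.comp hN1 hN1) hM1) (Primrec.nat_mul.comp hK hK))
    hr)).to_comp

/-- The running time and the numbers in the computation are bounded by `timeFactor` times the length
of the input. -/
lemma time_bounds {N M K r E V : ℕ} (hV : V ≤ E + 1) (X Z : ℕ) (hX : X = 8 + 3 * E)
    (hZ : Z = 10000 * ((N + 1) * (N + 1) * (M + 1) * ((K + 1) * (K + 1)) * (r + 1)) * X) :
    (r * K + 1) * 17 + (K + 1) * 15 + 100 + ((N + 1) * ((r + 1) * (E + 1) * N * 1000 + 10) +
      (M + 1) * ((K + 1) * ((K + 1) * ((r + 1) * 30 + 60) + 30) + 30 + 10)) ≤ Z ∧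
    X + N * (r + (r + 1) * V) < Z ∧ N < Z ∧ M < Z ∧ K < Z ∧ r + 1 < Z ∧ r * K < Z ∧
    K * (K * r) < Z := by
  obtain ⟨Y, hY⟩ : ∃ Y, Y = (N + 1) * (N + 1) * (M + 1) * ((K + 1) * (K + 1)) * (r + 1) * X :=
    ⟨_, rfl⟩
  have hZY : Z = 10000 * Y := by rw [hZ, hY]; ring
  -- Every monomial to be bounded takes from each factor of `Y` a part or just 1.
  have key : ∀ n m k q x : ℕ, n ≤ (N + 1) * (N + 1) → m ≤ M + 1 → k ≤ (K + 1) * (K + 1) →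
      q ≤ r + 1 → x ≤ X → n * m * k * q * x ≤ Y := by
    intro n m k q x hn hm hk hq hx
    rw [hY]
    gcongr
  have hN1 : 1 ≤ (N + 1) * (N + 1) := by nlinarith
  have hN2 : N + 1 ≤ (N + 1) * (N + 1) := by nlinarith
  have hM1 : 1 ≤ M + 1 := by omega
  have hK1 : 1 ≤ (K + 1) * (K + 1) := by nlinarith
  have hK2 : K + 1 ≤ (K + 1) * (K + 1) := by nlinarith
  have hr1 : 1 ≤ r + 1 := by omega
  have hX1 : 1 ≤ X := by omega
  have b0 := key 1 1 1 1 1 hN1 hM1 hK1 hr1 hX1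
  have b1 := key 1 1 (K + 1) (r + 1) 1 hN1 hM1 hK2 le_rfl hX1
  have b2 := key ((N + 1) * (N + 1)) 1 1 (r + 1) X le_rfl hM1 hK1 le_rfl le_rfl
  have b3 := key (N + 1) 1 1 1 1 hN2 hM1 hK1 hr1 hX1
  have b4 := key 1 (M + 1) ((K + 1) * (K + 1)) (r + 1) 1 hN1 le_rfl le_rfl le_rfl hX1
  have b5 := key 1 (M + 1) (K + 1) 1 1 hN1 le_rfl hK2 hr1 hX1
  have b6 := key 1 (M + 1) 1 1 1 hN1 le_rfl hK1 hr1 hX1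
  have b7 := key 1 (M + 1) ((K + 1) * (K + 1)) 1 1 hN1 le_rfl le_rfl hr1 hX1
  have b8 := key (N + 1) 1 1 (r + 1) X hN2 hM1 hK1 le_rfl le_rfl
  have b9 := key 1 1 1 1 X hN1 hM1 hK1 hr1 le_rfl
  have b10 := key 1 1 ((K + 1) * (K + 1)) (r + 1) 1 hN1 hM1 le_rfl le_rfl hX1
  simp only [one_mul, mul_one] at b0 b1 b2 b3 b4 b5 b6 b7 b8 b9 b10
  have c1 : (N + 1) * ((r + 1) * (E + 1) * N) ≤ Y := by
    refine le_trans ?_ b2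
    calc (N + 1) * ((r + 1) * (E + 1) * N) ≤ (N + 1) * ((r + 1) * X * (N + 1)) := by
          gcongr <;> omega
      _ = (N + 1) * (N + 1) * (r + 1) * X := by ring
  have c2 : N * (r + (r + 1) * V) ≤ 2 * Y := by
    calc N * (r + (r + 1) * V) ≤ (N + 1) * ((r + 1) * X + (r + 1) * X) := by
          gcongr
          · omega
          · nlinarith
          · omega
      _ = 2 * ((N + 1) * (r + 1) * X) := by ring
      _ ≤ 2 * Y := by omega
  have c3 : (M + 1) * ((K + 1) * ((K + 1) * ((r + 1) * 30 + 60) + 30) + 30 + 10) ≤ 160 * Y := by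
    calc _ = 30 * ((M + 1) * ((K + 1) * (K + 1)) * (r + 1)) +
          60 * ((M + 1) * ((K + 1) * (K + 1))) + 30 * ((M + 1) * (K + 1)) + 40 * (M + 1) := by ring
      _ ≤ 160 * Y := by omega
  have c4 : (N + 1) * ((r + 1) * (E + 1) * N * 1000 + 10) ≤ 1010 * Y := by
    calc _ = 1000 * ((N + 1) * ((r + 1) * (E + 1) * N)) + 10 * (N + 1) := by ring
      _ ≤ 1010 * Y := by omega
  have c5 : r * K ≤ Y := by
    refine le_trans ?_ b1
    rw [mul_comm]
    gcongr <;> omega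
  have c6 : K * (K * r) ≤ Y := by
    refine le_trans ?_ b10
    rw [← mul_assoc]
    gcongr <;> omega
  have c7 : K + 1 ≤ Y := (Nat.le_mul_of_pos_right _ (by omega)).trans b1
  have c8 : r + 1 ≤ Y := (Nat.le_mul_of_pos_left _ (by omega)).trans b1
  subst hZY
  -- The time is below 1400 `Y` and the memory at most 3 `Y`, so the constant 10000 leaves ample
  -- room, also for the strict inequalities.
  refine ⟨?_, ?_, ?_, ?_, ?_, ?_, ?_, ?_⟩ <;> omega

end WordRAM

theorem mainTheorem7 :
    WordRAM.FixedParameterTractable DiverseInstance.encode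
      (fun I : DiverseInstance => (I.K, I.r)) DiverseInstance.IsYes := by
  -- Exponent 1 suffices: for fixed parameters the time is linear in the input length.
  refine ⟨WordRAM.diverseProg, WordRAM.timeFactor, 1, WordRAM.computable_timeFactor, one_pos, ?_⟩
  intro I w hI hw
  change WordRAM.timeFactor (I.K, I.r) * I.encode.length ^ 1 ≤ 2 ^ w at hw
  obtain ⟨h1, h2, h3, h4, h5, h6, h7, h8⟩ := WordRAM.time_bounds (N := WordRAM.treeSize I)
    (M := WordRAM.treeSize I ^ I.K) (K := I.K) (r := I.r) I.numV_le I.encode.length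
    (WordRAM.timeFactor (I.K, I.r) * I.encode.length ^ 1) I.encode_length (by rw [pow_one]; rfl)
  have hone : 1 < 2 ^ w := by omega
  have h2' : WordRAM.base I + WordRAM.treeSize I * WordRAM.stride I < 2 ^ w := by
    have := h2.trans_le hw
    rwa [I.encode_length] at this
  obtain ⟨T, hT, S, hS, hrun, hyes, hno⟩ := WordRAM.ok_diverseProg (w := w) (I := I)
    (S := ⟨fun _ => 0, I.word⟩) (fun _ => rfl) (fun _ => rfl) h2' (h3.trans_le hw)
    (h4.trans_le hw) (h5.trans_le hw) (h6.trans_le hw) (h7.trans_le hw) (h8.trans_le hw)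
    ⟨hone, fun _ => zero_lt_one.trans hone, fun a => by
      rcases lt_or_ge a I.encode.length with ha | ha
      · refine hI _ ?_
        change I.encode.getD a 0 ∈ I.encode
        rw [List.getD_eq_getElem _ _ ha]
        exact List.getElem_mem _
      · change I.encode.getD a 0 < _
        rw [List.getD_eq_default _ _ ha]
        omega⟩
  refine ⟨T, S.config w, hrun, hT.trans h1, ?_⟩
  change BitVec.ofNat w (S.reg 0) = _
  split_ifs with h
  · rw [hyes h]
    rfl
  · rw [hno h]
    rfl
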